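/- Let $s\in(0,1)$, $\varepsilon>0$. For $u:\mathbb R\to\mathbb R$ put $$(-\Delta)^s u(x)=C_s\,\mathrm{P.V.}\!\int_{\mathbb R}\frac{u(x)-u(y)}{|x-y|^{1+2s}}\,dy,\qquad C_s=\frac{4^s\,\Gamma(\tfrac12+s)}{\sqrt{\pi}\,|\Gamma(-s)|},$$ $$\mathcal L^s u=\partial_v(vu)-(-\Delta_v)^s u,\qquad I(p,q)(v)=C_s\int_{\mathbb R}\frac{(p(v)-p(w))(q(w)-q(v))}{|v-w|^{1+2s}}\,dw .$$ Let $\mathcal M$ be the equilibrium: a positive $C^2$ function on $\mathbb R$ with $\mathcal L^s\mathcal M=0$ and $\int_{\mathbb R}\mathcal M\,dv=1$. Let $f_{in}:\mathbb R\times\mathbb R\to\mathbb R$ be measurable with $E_{f,in}^2:=\iint f_{in}^2/\mathcal M\,dv\,dx<\infty$, and set $$\rho_{in}(x)=\int_{\mathbb R} f_{in}(x,v)\,dv,\qquad \eta_{in}(x,v)=\rho_{in}(x+\varepsilon v),\qquad g_{in}=f_{in}-\eta_{in}\mathcal M .$$ Let $(\eta,g)$, functions of $(t,x,v)\in(0,\infty)\times\mathbb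 R\times\mathbb R$, be a solution of the system $$\varepsilon^{2s}\partial_t g+\varepsilon v\,\partial_x g=\mathcal L^s(g)-I(\eta,\mathcal M),\qquad \partial_t\eta=-(-\Delta_x)^s\eta,$$ with initial data $(\eta_{in},g_{in})$, in the following sense: $\eta$ and $g$ are of class $C^2$ for $t>0$; the nonlocal terms $(-\Delta_v)^s g$, $(-\Delta_x)^s\eta$ and $I(\eta,\mathcal M)$ converge and both equations hold at every point with $t>0$; $\eta(t)\to\eta_{in}$ and $g(t)\to g_{in}$ in $L^2_{loc}(\mathbb R^2)$ as $t\to0^+$; and the energies $$E_\eta^2(t)=\iint\eta^2\mathcal M\,dx\,dv,\qquad E_g^2(t)=\iint\frac{g^2}{\mathcal M}\,dx\,dv$$ satisfy $\int_0^T (E_\eta^2+E_g^2)\,dt<\infty$ for every $T>0$. Put $f=\eta\mathcal M+g$, $E_f^2(t)=\iint f^2/\mathcal M\,dx\,dv$ and $E_{\eta,in}^2=\iint\eta_{in}^2\mathcal M\,dx\,dv$. Then: 1. $E_\eta$ is non-increasing on $(0,\infty)$, $E_{\eta,in}<\infty$, and $E_\eta(t)\le E_{\eta,in}$ for all $t>0$;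 2. for all $t>0$, $E_g^2(t)\le 2E_f^2(t)+2E_\eta^2(t)$ and $E_g^2(t)\le 2E_{f,in}^2+2E_{\eta,in}^2$. In particular $E_\eta$ and $E_g$ are uniformly bounded in time. -/

import Mathlib

open Set Filter Topology MeasureTheory
open scoped ENNReal NNReal

noncomputable section

namespace LevyFokkerPlanck

/-- The normalizing constant `C_{s,1} = 4^s Γ(1/2 + s) / (π^{1/2} |Γ(-s)|)` of the
one-dimensional fractional Laplacian. -/
def fracLapConst (s : ℝ) : ℝ :=
  (4 : ℝ) ^ s * Real.Gamma (1 / 2 + s) / (Real.sqrt Real.pi * |Real.Gamma (-s)|)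

/-- `(-Δ)^s u (x)` exists and equals `l`, where
`(-Δ)^s u (x) = C_{s,1} P.V. ∫ (u(x) - u(y)) / |x - y|^{1+2s} dy`: the integrals over
`|x - y| ≥ δ` converge absolutely for every `δ > 0`, and have the limit `l` as `δ → 0+`. -/
def HasFracLaplacian (s : ℝ) (u : ℝ → ℝ) (x l : ℝ) : Prop :=
  (∀ δ : ℝ, 0 < δ →
    IntegrableOn (fun y => (u x - u y) / |x - y| ^ (1 + 2 * s)) {y | δ ≤ |x - y|}) ∧
  Tendsto
    (fun δ : ℝ =>
      fracLapConst s * ∫ y in {y | δ ≤ |x - y|}, (u x - u y) / |x - y| ^ (1 + 2 * s))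
    (𝓝[>] 0) (𝓝 l)

/-- `𝓛^s u (v)` exists and equals `l`, where `𝓛^s u = ∂_v (v u) - (-Δ_v)^s u`
is the Lévy-Fokker-Planck operator. -/
def HasLevyFokkerPlanck (s : ℝ) (u : ℝ → ℝ) (v l : ℝ) : Prop :=
  DifferentiableAt ℝ u v ∧
  ∃ a : ℝ, HasFracLaplacian s u v a ∧ l = deriv (fun w => w * u w) v - a

/-- The integrand of the bilinear commutator `I(p, q)(v)`. -/
def commIntegrand (s : ℝ) (p q : ℝ → ℝ) (v w : ℝ) : ℝ :=
  (p v - p w) * (q w - q v) / |v - w| ^ (1 + 2 * s)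

/-- `I(p, q)(v) = C_{s,1} ∫ (p(v) - p(w)) (q(w) - q(v)) / |v - w|^{1+2s} dw`. -/
def comm (s : ℝ) (p q : ℝ → ℝ) (v : ℝ) : ℝ :=
  fracLapConst s * ∫ w, commIntegrand s p q v w

/-- The normalized equilibrium: a positive `C²` density with `𝓛^s M = 0` and `∫ M = 1`. -/
structure IsEquilibrium (s : ℝ) (M : ℝ → ℝ) : Prop where
  contDiff : ContDiff ℝ 2 M
  pos : ∀ v, 0 < M v
  equation : ∀ v, HasLevyFokkerPlanck s M v 0
  integral_eq_one : ∫ v, M v = 1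

/-- `∬ u² M dx dv`, with values in `[0, ∞]`; this is `E_η²` for `u = η(t)`. -/
def macroEnergySq (M : ℝ → ℝ) (u : ℝ → ℝ → ℝ) : ℝ≥0∞ :=
  ∫⁻ x, ∫⁻ v, ENNReal.ofReal (u x v ^ 2 * M v)

/-- `∬ u² / M dx dv`, with values in `[0, ∞]`; this is `E_g²` for `u = g(t)`, and the square
`E_f²` of the total energy for `u = f(t)`. -/
def kineticEnergySq (M : ℝ → ℝ) (u : ℝ → ℝ → ℝ) : ℝ≥0∞ :=
  ∫⁻ x, ∫⁻ v, ENNReal.ofReal (u x v ^ 2 / M v)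

/-- The initial density `ρ_in(x) = ∫ f_in(x, v) dv`. -/
def initialDensity (fin : ℝ → ℝ → ℝ) (x : ℝ) : ℝ := ∫ v, fin x v

/-- `η_in(x, v) = ρ_in(x + ε v)`. -/
def etaIn (ε : ℝ) (fin : ℝ → ℝ → ℝ) (x v : ℝ) : ℝ := initialDensity fin (x + ε * v)

/-- `g_in(x, v) = f_in(x, v) - η_in(x, v) M(v)`. -/
def gIn (ε : ℝ) (M : ℝ → ℝ) (fin : ℝ → ℝ → ℝ) (x v : ℝ) : ℝ := fin x v - etaIn ε fin x v * M v

/-- `u(t) → u₀` in `L²_loc(ℝ²)` as `t → 0+`. -/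
def AttainsInitialData (u : ℝ → ℝ → ℝ → ℝ) (u₀ : ℝ → ℝ → ℝ) : Prop :=
  ∀ R : ℝ, Tendsto
    (fun t => ∫⁻ x in Icc (-R) R, ∫⁻ v in Icc (-R) R, ENNReal.ofReal ((u t x v - u₀ x v) ^ 2))
    (𝓝[>] 0) (𝓝 0)

/-- A finite-energy solution `(η, g)`, written as functions of `(t, x, v)`, of the split system
`ε^{2s} ∂_t g + ε v ∂_x g = 𝓛^s g - I(η, M)`, `∂_t η = -(-Δ_x)^s η` with initial data
`η_in(x, v) = ρ_in(x + ε v)`, `g_in = f_in - η_in M`. The functions are `C²` for `t > 0`, the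
equations hold at every point with `t > 0`, all nonlocal terms being convergent, the initial data
are attained in `L²_loc`, and `E_η²`, `E_g²` are integrable on bounded time intervals. -/
structure IsSolution (s ε : ℝ) (M : ℝ → ℝ) (fin : ℝ → ℝ → ℝ) (η g : ℝ → ℝ → ℝ → ℝ) : Prop where
  contDiffOn_eta :
    ContDiffOn ℝ 2 (fun p : ℝ × ℝ × ℝ => η p.1 p.2.1 p.2.2) (Ioi (0 : ℝ) ×ˢ univ)
  contDiffOn_g :
    ContDiffOn ℝ 2 (fun p : ℝ × ℝ × ℝ => g p.1 p.2.1 p.2.2) (Ioi (0 : ℝ) ×ˢ univ)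
  comm_integrable : ∀ t : ℝ, 0 < t → ∀ x v : ℝ, Integrable (commIntegrand s (η t x) M v)
  micro_equation : ∀ t : ℝ, 0 < t → ∀ x v : ℝ, ∃ l : ℝ, HasLevyFokkerPlanck s (g t x) v l ∧
    ε ^ (2 * s) * deriv (fun τ => g τ x v) t + ε * v * deriv (fun y => g t y v) x
      = l - comm s (η t x) M v
  macro_equation : ∀ t : ℝ, 0 < t → ∀ x v : ℝ, ∃ l : ℝ,
    HasFracLaplacian s (fun y => η t y v) x l ∧ deriv (fun τ => η τ x v) t = -l
  initial_eta : AttainsInitialData η (etaIn ε fin)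
  initial_g : AttainsInitialData g (gIn ε M fin)
  energy_eta : ∀ T : ℝ, ∫⁻ t in Ioo 0 T, macroEnergySq M (η t) < ∞
  energy_g : ∀ T : ℝ, ∫⁻ t in Ioo 0 T, kineticEnergySq M (g t) < ∞

end LevyFokkerPlanck

end

/-!
# Energy bounds for the split Lévy-Fokker-Planck system

All the bounds come from one estimate. Let `m > 0` satisfy `κ ∂_v(v m) = (-Δ_v)^s m` and let `u`
be a classical solution of `a ∂_t u + b v ∂_x u = κ ∂_v(v u) - (-Δ_v)^s u` with
`∫_0^T ∬ u² / m < ∞`. The density `e = u² / m` is a pointwise subsolution of the same equation,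
because `2 F f(w) - F² m(w) ≤ f(w)² / m(w)` with `F = f(v) / m(v)` (`truncLap_quotient_le`). The
equation conserves mass, and `e` is integrable on `(0, T) × ℝ²`, so it suffices to test with a
cutoff: all derivatives and the fractional Laplacian fall on the cutoff at scale `R` in `v` and `R²`
in `x`, where they are bounded and tend to zero as `R → ∞`. No decay or regularity of `u` at
infinity is needed. As the error only involves the time integral of the energy, the initial time
can be reached with `L²_loc` convergence alone (`IsKineticSolution.exists_energy_error`,
`IsKineticSolution.kineticEnergySq_antitone`, `IsKineticSolution.kineticEnergySq_le_initial`). The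
truncated nonlocal operator is symmetric (`integrable_mul_truncLap_and_integral_comm`), and the
truncation is removed by dominated convergence, thanks to uniform local bounds for `C²` functions
(`exists_bound_truncLap`).

The fractional heat equation for `η` is the case `b = κ = 0` with the constant stationary state
(`IsHeatSolution.isKineticSolution`), which gives the bounds on `E_η`. Applied to a difference of
translates it also gives uniqueness, hence `η(t, x, v) = η(t, x + ε c, v - c)`
(`IsSolution.eta_eq_translate`). Therefore `∂_v η = ε ∂_x η` and
`(-Δ_v)^s η = ε^{2s} (-Δ_x)^s η`, and by the Leibniz rule with defect `I(η, M)` the total density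
`f = η M + g` solves the kinetic equation with `a = ε^{2s}`, `b = ε`, `κ = 1`, `m = M`
(`IsSolution.isKineticSolution`). So `E_f` is at most its initial value, and the bounds on `E_g`
follow from `g = f - η M`.
-/

noncomputable section

namespace LevyFokkerPlanck

/-! ### The truncated kernel and the truncated fractional Laplacian -/

/-- The kernel `|h|^{-(1+2s)}` of the fractional Laplacian, cut off below the scale `δ`. -/
def truncKernel (s δ h : ℝ) : ℝ := {h : ℝ | δ ≤ |h|}.indicator (fun h => (|h| ^ (1 + 2 * s))⁻¹) h

/-- The fractional Laplacian without its normalizing constant, with the interactions at distance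
less than `δ` removed. -/
def truncLap (s δ : ℝ) (u : ℝ → ℝ) (x : ℝ) : ℝ := ∫ y, (u x - u y) * truncKernel s δ (x - y)

/-- The second difference `2 u(x) - u(x + h) - u(x - h)`. -/
def secondDiff (u : ℝ → ℝ) (x h : ℝ) : ℝ := 2 * u x - u (x + h) - u (x - h)

theorem fracLapConst_nonneg {s : ℝ} (hs : s ∈ Ioo (0 : ℝ) 1) : 0 ≤ fracLapConst s := by
  have h : 0 < Real.Gamma (1 / 2 + s) := Real.Gamma_pos_of_pos (by linarith [hs.1])
  unfold fracLapConst
  positivity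

theorem measurableSet_le_abs (δ : ℝ) : MeasurableSet {h : ℝ | δ ≤ |h|} :=
  measurableSet_le measurable_const measurable_id.abs

theorem truncKernel_nonneg (s δ h : ℝ) : 0 ≤ truncKernel s δ h :=
  indicator_nonneg (fun _ _ => by positivity) h

theorem truncKernel_le_kernel (s δ h : ℝ) : truncKernel s δ h ≤ (|h| ^ (1 + 2 * s))⁻¹ :=
  indicator_le_self' (fun _ _ => by positivity) h

theorem truncKernel_neg (s δ h : ℝ) : truncKernel s δ (-h) = truncKernel s δ h := by
  simp [truncKernel, indicator]

theorem truncKernel_sub_comm (s δ x y : ℝ) : truncKernel s δ (x - y) = truncKernel s δ (y - x) := by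
  rw [← truncKernel_neg, neg_sub]

@[fun_prop]
theorem measurable_truncKernel (s δ : ℝ) : Measurable (truncKernel s δ) := by
  unfold truncKernel
  exact Measurable.indicator (by fun_prop) (measurableSet_le_abs δ)

theorem truncKernel_le {s δ : ℝ} (hs : 0 < s) (hδ : 0 < δ) (h : ℝ) :
    truncKernel s δ h ≤ (δ ^ (1 + 2 * s))⁻¹ := by
  refine indicator_apply_le' (fun hh => ?_) (fun _ => by positivity)
  have hh : δ ≤ |h| := hh
  gcongr

/-- The Lévy condition: `min(1, h²)` is integrable against the kernel. -/
theorem integrable_min_sq_mul_kernel {s : ℝ} (hs : s ∈ Ioo (0 : ℝ) 1) :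
    Integrable (fun h : ℝ => min 1 (h ^ 2) * (|h| ^ (1 + 2 * s))⁻¹) := by
  have key := integrable_fun_norm_addHaar (volume : Measure ℝ)
    (f := fun r : ℝ => min 1 (r ^ 2) * (r ^ (1 + 2 * s))⁻¹)
  simp only [Real.norm_eq_abs, sq_abs, Module.finrank_self, tsub_self, pow_zero, one_smul] at key
  rw [key, ← Ioc_union_Ioi_eq_Ioi zero_le_one, integrableOn_union]
  constructor
  · have h1 : IntegrableOn (fun r : ℝ => r ^ (1 - 2 * s)) (Ioc 0 1) :=
      (intervalIntegrable_iff_integrableOn_Ioc_of_le zero_le_one).1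
        (intervalIntegral.intervalIntegrable_rpow' (by linarith [hs.2]))
    refine h1.congr_fun (fun r hr => ?_) measurableSet_Ioc
    have hr2 : r ^ 2 ≤ 1 := pow_le_one₀ hr.1.le hr.2
    simp only [min_eq_right hr2]
    rw [← Real.rpow_natCast, ← Real.rpow_neg hr.1.le, ← Real.rpow_add hr.1]
    congr 1
    push_cast
    ring
  · have h1 : IntegrableOn (fun r : ℝ => r ^ (-(1 + 2 * s))) (Ioi 1) :=
      integrableOn_Ioi_rpow_of_lt (by linarith [hs.1]) one_pos
    refine h1.congr_fun (fun r hr => ?_) measurableSet_Ioi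
    have hr : 1 < r := hr
    have hr2 : 1 ≤ r ^ 2 := one_le_pow₀ hr.le
    simp only [min_eq_left hr2, one_mul]
    rw [Real.rpow_neg (by linarith)]

theorem integrable_truncKernel {s δ : ℝ} (hs : s ∈ Ioo (0 : ℝ) 1) (hδ : 0 < δ) :
    Integrable (truncKernel s δ) := by
  refine ((integrable_min_sq_mul_kernel hs).const_mul (1 + (δ ^ 2)⁻¹)).mono'
    (measurable_truncKernel s δ).aestronglyMeasurable (ae_of_all _ fun h => ?_)
  rw [Real.norm_of_nonneg (truncKernel_nonneg _ _ _)]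
  refine indicator_apply_le' (fun hh => ?_) (fun _ => by positivity)
  have hh : δ ≤ |h| := hh
  rw [← mul_assoc]
  refine le_mul_of_one_le_left (by positivity) ?_
  have h2 : δ ^ 2 ≤ h ^ 2 := by rw [← sq_abs h]; gcongr
  have h3 : 1 ≤ (δ ^ 2)⁻¹ * h ^ 2 := by
    rw [inv_mul_eq_div, one_le_div (by positivity)]; exact h2
  rcases min_cases 1 (h ^ 2) with ⟨h4, -⟩ | ⟨h4, -⟩ <;> rw [h4]
  · have : 0 ≤ (δ ^ 2)⁻¹ := by positivity
    linarith
  · nlinarith [sq_nonneg h]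

theorem div_kernel_indicator (s δ : ℝ) (u : ℝ → ℝ) (x y : ℝ) :
    {y | δ ≤ |x - y|}.indicator (fun y => (u x - u y) / |x - y| ^ (1 + 2 * s)) y =
      (u x - u y) * truncKernel s δ (x - y) := by
  simp only [truncKernel, indicator, mem_ofPred_eq, div_eq_mul_inv]
  split_ifs <;> simp

theorem measurableSet_le_abs_sub (δ x : ℝ) : MeasurableSet {y : ℝ | δ ≤ |x - y|} :=
  measurableSet_le measurable_const (by fun_prop)

/-- The fractional Laplacian in terms of the truncated ones. -/
theorem hasFracLaplacian_iff (s : ℝ) (u : ℝ → ℝ) (x l : ℝ) :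
    HasFracLaplacian s u x l ↔
      (∀ δ : ℝ, 0 < δ → Integrable fun y => (u x - u y) * truncKernel s δ (x - y)) ∧
      Tendsto (fun δ => fracLapConst s * truncLap s δ u x) (𝓝[>] 0) (𝓝 l) := by
  unfold HasFracLaplacian truncLap
  simp only [← integrable_indicator_iff (measurableSet_le_abs_sub _ x),
    ← integral_indicator (measurableSet_le_abs_sub _ x)]
  have : ∀ δ : ℝ, {y | δ ≤ |x - y|}.indicator (fun y => (u x - u y) / |x - y| ^ (1 + 2 * s)) =
      fun y => (u x - u y) * truncKernel s δ (x - y) :=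
    fun δ => funext (div_kernel_indicator s δ u x)
  simp only [this]

theorem HasFracLaplacian.integrable {s : ℝ} {u : ℝ → ℝ} {x l : ℝ} (h : HasFracLaplacian s u x l)
    {δ : ℝ} (hδ : 0 < δ) : Integrable fun y => (u x - u y) * truncKernel s δ (x - y) :=
  ((hasFracLaplacian_iff s u x l).1 h).1 δ hδ

theorem HasFracLaplacian.tendsto {s : ℝ} {u : ℝ → ℝ} {x l : ℝ} (h : HasFracLaplacian s u x l) :
    Tendsto (fun δ => fracLapConst s * truncLap s δ u x) (𝓝[>] 0) (𝓝 l) :=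
  ((hasFracLaplacian_iff s u x l).1 h).2

theorem HasFracLaplacian.add {s : ℝ} {u w : ℝ → ℝ} {x a b : ℝ} (hu : HasFracLaplacian s u x a)
    (hw : HasFracLaplacian s w x b) : HasFracLaplacian s (fun y => u y + w y) x (a + b) := by
  rw [hasFracLaplacian_iff]
  have e : ∀ δ, (fun y => (u x + w x - (u y + w y)) * truncKernel s δ (x - y)) =
      fun y => (u x - u y) * truncKernel s δ (x - y) + (w x - w y) * truncKernel s δ (x - y) :=
    fun δ => by ext y; ring
  refine ⟨fun δ hδ => ?_, (hu.tendsto.add hw.tendsto).congr' ?_⟩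
  · rw [e]; exact (hu.integrable hδ).add (hw.integrable hδ)
  · filter_upwards [self_mem_nhdsWithin] with δ hδ
    simp only [truncLap]
    rw [e, integral_add (hu.integrable hδ) (hw.integrable hδ), mul_add]

theorem HasFracLaplacian.const_mul {s : ℝ} {u : ℝ → ℝ} {x a : ℝ} (hu : HasFracLaplacian s u x a)
    (c : ℝ) : HasFracLaplacian s (fun y => c * u y) x (c * a) := by
  rw [hasFracLaplacian_iff]
  have e : ∀ δ, (fun y => (c * u x - c * u y) * truncKernel s δ (x - y)) =
      fun y => c * ((u x - u y) * truncKernel s δ (x - y)) :=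
    fun δ => by ext y; ring
  refine ⟨fun δ hδ => ?_, (hu.tendsto.const_mul c).congr' ?_⟩
  · rw [e]; exact (hu.integrable hδ).const_mul c
  · filter_upwards [self_mem_nhdsWithin] with δ hδ
    simp only [truncLap]
    rw [e, integral_const_mul]; ring

theorem hasFracLaplacian_const (s c x : ℝ) : HasFracLaplacian s (fun _ => c) x 0 := by
  rw [hasFracLaplacian_iff]
  simp [truncLap]

theorem HasFracLaplacian.comp_affine {s : ℝ} {u : ℝ → ℝ} {x l : ℝ} (hu : HasFracLaplacian s u x l)
    {r : ℝ} (hr : 0 < r) (v : ℝ) :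
    HasFracLaplacian s (fun w => u (x + r * (w - v))) v (r ^ (2 * s) * l) := by
  have hk : ∀ δ h, truncKernel s δ h = r ^ (1 + 2 * s) * truncKernel s (r * δ) (r * h) := by
    intro δ h
    simp only [truncKernel, indicator, mem_ofPred_eq, abs_mul, abs_of_pos hr,
      mul_le_mul_iff_right₀ hr]
    split_ifs
    · rw [Real.mul_rpow hr.le (abs_nonneg h), mul_inv, ← mul_assoc, mul_inv_cancel₀ (by positivity),
        one_mul]
    · simp
  have e : ∀ δ, (fun w => (u (x + r * (v - v)) - u (x + r * (w - v))) * truncKernel s δ (v - w)) =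
      fun w => r ^ (1 + 2 * s) * (fun y => (u x - u y) * truncKernel s (r * δ) (x - y))
        ((x - r * v) + r * w) := by
    intro δ
    ext w
    rw [hk δ]
    have h1 : r * (v - w) = x - (x - r * v + r * w) := by ring
    have h2 : x + r * (w - v) = x - r * v + r * w := by ring
    simp only [sub_self, mul_zero, add_zero, h2]
    rw [h1]; ring
  rw [hasFracLaplacian_iff]
  have hlim : Tendsto (fun δ : ℝ => r * δ) (𝓝[>] 0) (𝓝[>] 0) := by
    refine tendsto_nhdsWithin_iff.2 ⟨?_, ?_⟩
    · have : Tendsto (fun δ : ℝ => r * δ) (𝓝 0) (𝓝 (r * 0)) := tendsto_id.const_mul r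
      rw [mul_zero] at this
      exact this.mono_left nhdsWithin_le_nhds
    · filter_upwards [self_mem_nhdsWithin] with δ hδ
      exact mul_pos hr hδ
  refine ⟨fun δ hδ => ?_, ((hu.tendsto.comp hlim).const_mul (r ^ (2 * s))).congr' ?_⟩
  · rw [e]
    exact (((hu.integrable (mul_pos hr hδ)).comp_add_left (x - r * v)).comp_mul_left'
      hr.ne').const_mul _
  · filter_upwards with δ
    simp only [truncLap, Function.comp]
    rw [e, integral_const_mul]
    have h3 := Measure.integral_comp_mul_left (fun z => (fun y => (u x - u y) *
      truncKernel s (r * δ) (x - y)) (x - r * v + z)) r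
    rw [h3, integral_add_left_eq_self (fun y => (u x - u y) * truncKernel s (r * δ) (x - y)),
      Real.rpow_add hr, Real.rpow_one, abs_of_pos (inv_pos.2 hr), smul_eq_mul]
    field_simp

/-- The fractional Laplacian of a product: the bilinear commutator `I` is the defect in the
Leibniz rule. -/
theorem HasFracLaplacian.mul {s : ℝ} {p q : ℝ → ℝ} {x a b : ℝ} (hp : HasFracLaplacian s p x a)
    (hq : HasFracLaplacian s q x b) (hpq : Integrable (commIntegrand s p q x)) :
    HasFracLaplacian s (fun y => p y * q y) x (q x * a + p x * b + comm s p q x) := by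
  have hc : ∀ δ y, {y | δ ≤ |x - y|}.indicator (commIntegrand s p q x) y =
      (p x - p y) * (q y - q x) * truncKernel s δ (x - y) := by
    intro δ y
    simp only [truncKernel, indicator, mem_ofPred_eq, commIntegrand, div_eq_mul_inv]
    split_ifs <;> simp
  have e : ∀ δ, (fun y => (p x * q x - p y * q y) * truncKernel s δ (x - y)) =
      fun y => q x * ((p x - p y) * truncKernel s δ (x - y)) +
        p x * ((q x - q y) * truncKernel s δ (x - y)) +
        {y | δ ≤ |x - y|}.indicator (commIntegrand s p q x) y := by
    intro δ; ext y; rw [hc]; ring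
  have hi : ∀ δ, Integrable ({y | δ ≤ |x - y|}.indicator (commIntegrand s p q x)) :=
    fun δ => hpq.indicator (measurableSet_le_abs_sub δ x)
  have hlim : Tendsto (fun δ => fracLapConst s *
      ∫ y, {y | δ ≤ |x - y|}.indicator (commIntegrand s p q x) y) (𝓝[>] 0)
      (𝓝 (comm s p q x)) := by
    refine Tendsto.const_mul _ ?_
    refine tendsto_integral_filter_of_dominated_convergence (fun y => ‖commIntegrand s p q x y‖)
      (Eventually.of_forall fun δ => (hi δ).aestronglyMeasurable)
      (Eventually.of_forall fun δ => ae_of_all _ fun y => norm_indicator_le_norm_self _ _)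
      hpq.norm ?_
    filter_upwards [compl_mem_ae_iff.2 (measure_singleton x)] with y hy
    have hy : 0 < |x - y| := abs_pos.2 (sub_ne_zero.2 (Ne.symm hy))
    refine tendsto_const_nhds.congr' ?_
    filter_upwards [Ioo_mem_nhdsGT hy] with δ hδ
    rw [indicator_of_mem]
    exact hδ.2.le
  have h1 : ∀ δ : ℝ, 0 < δ → Integrable fun y => q x * ((p x - p y) * truncKernel s δ (x - y)) +
      p x * ((q x - q y) * truncKernel s δ (x - y)) := fun δ hδ =>
    ((hp.integrable hδ).const_mul _).add ((hq.integrable hδ).const_mul _)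
  rw [hasFracLaplacian_iff]
  refine ⟨fun δ hδ => ?_, (((hp.tendsto.const_mul (q x)).add
    (hq.tendsto.const_mul (p x))).add hlim).congr' ?_⟩
  · rw [e]
    exact (h1 δ hδ).add (hi δ)
  · filter_upwards [self_mem_nhdsWithin] with δ hδ
    simp only [truncLap]
    rw [e, integral_add (h1 δ hδ) (hi δ), integral_add ((hp.integrable hδ).const_mul _)
      ((hq.integrable hδ).const_mul _), integral_const_mul, integral_const_mul]
    ring

/-! ### Bounds on truncated fractional Laplacians -/

theorem truncLap_eq_integral_secondDiff {s δ : ℝ} {u : ℝ → ℝ} {x : ℝ}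
    (h : Integrable fun y => (u x - u y) * truncKernel s δ (x - y)) :
    truncLap s δ u x = (∫ z, secondDiff u x z * truncKernel s δ z) / 2 := by
  have h1 : Integrable fun z => (u x - u (x - z)) * truncKernel s δ z := by
    simpa using h.comp_sub_left x
  have h2 : Integrable fun z => (u x - u (x + z)) * truncKernel s δ z := by
    simpa [truncKernel_neg] using h.comp_add_left x
  have e1 : ∫ z, (u x - u (x - z)) * truncKernel s δ z = truncLap s δ u x := by
    simpa [truncLap] using integral_sub_left_eq_self
      (fun y => (u x - u y) * truncKernel s δ (x - y)) volume x
  have e2 : ∫ z, (u x - u (x + z)) * truncKernel s δ z = truncLap s δ u x := by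
    simpa [truncKernel_neg, truncLap] using integral_add_left_eq_self
      (μ := volume) (fun y => (u x - u y) * truncKernel s δ (x - y)) x
  have e3 : ∫ z, secondDiff u x z * truncKernel s δ z =
      ∫ z, ((u x - u (x - z)) * truncKernel s δ z + (u x - u (x + z)) * truncKernel s δ z) := by
    congr 1; ext z; simp only [secondDiff]; ring
  rw [e3, integral_add h1 h2, e1, e2]
  ring

theorem abs_truncLap_le {s δ : ℝ} {u N : ℝ → ℝ} {x : ℝ}
    (h : Integrable fun y => (u x - u y) * truncKernel s δ (x - y)) (hN : Integrable N)
    (hle : ∀ z, |secondDiff u x z| * truncKernel s δ z ≤ N z) :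
    |truncLap s δ u x| ≤ ∫ z, N z := by
  have h1 : |∫ z, secondDiff u x z * truncKernel s δ z| ≤ ∫ z, N z := by
    rw [← Real.norm_eq_abs]
    refine norm_integral_le_of_norm_le hN (ae_of_all _ fun z => ?_)
    rw [Real.norm_eq_abs, abs_mul, abs_of_nonneg (truncKernel_nonneg s δ z)]
    exact hle z
  rw [truncLap_eq_integral_secondDiff h, abs_div, abs_two]
  have := abs_nonneg (∫ z, secondDiff u x z * truncKernel s δ z)
  linarith

/-- A function with Lipschitz derivative has quadratically small second differences. -/
theorem abs_secondDiff_le {u : ℝ → ℝ} (hu : Differentiable ℝ u) {x h K : ℝ}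
    (hK : ∀ a ∈ Icc (x - |h|) (x + |h|), ∀ b ∈ Icc (x - |h|) (x + |h|),
      |deriv u a - deriv u b| ≤ K * |a - b|) (hK0 : 0 ≤ K) :
    |secondDiff u x h| ≤ 2 * K * h ^ 2 := by
  have hd : ∀ r ∈ Icc (-|h|) |h|, HasDerivWithinAt (fun r => u (x + r) + u (x - r))
      (deriv u (x + r) - deriv u (x - r)) (Icc (-|h|) |h|) r := by
    intro r _
    have h1 : HasDerivAt (fun r => u (x + r)) (deriv u (x + r)) r :=
      (hu (x + r)).hasDerivAt.comp_const_add x r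
    have h2 : HasDerivAt (fun r => u (x - r)) (-deriv u (x - r)) r :=
      (hu (x - r)).hasDerivAt.comp_const_sub x r
    exact (h1.add h2).hasDerivWithinAt
  have hb : ∀ r ∈ Icc (-|h|) |h|, ‖deriv u (x + r) - deriv u (x - r)‖ ≤ 2 * K * |h| := by
    intro r hr
    have h1 := hK (x + r) ⟨by linarith [hr.1], by linarith [hr.2]⟩ (x - r)
      ⟨by linarith [hr.2], by linarith [hr.1]⟩
    have h2 : |x + r - (x - r)| = 2 * |r| := by
      rw [add_sub_sub_cancel, ← two_mul, abs_mul, abs_two]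
    rw [h2] at h1
    have h3 : |r| ≤ |h| := abs_le.2 hr
    rw [Real.norm_eq_abs]
    nlinarith
  have key := (convex_Icc (-|h|) |h|).norm_image_sub_le_of_norm_hasDerivWithin_le hd hb
    (x := 0) (y := h) ⟨by simp, by simp⟩ ⟨neg_abs_le h, le_abs_self h⟩
  rw [Real.norm_eq_abs, Real.norm_eq_abs, abs_sub_comm] at key
  simp only [sub_zero] at key
  rw [← sq_abs h]
  calc |secondDiff u x h| = |u (x + 0) + u (x - 0) - (u (x + h) + u (x - h))| := by
        congr 1; simp only [secondDiff, add_zero, sub_zero]; ring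
    _ ≤ 2 * K * |h| ^ 2 := by simp only [sub_zero]; linarith

theorem exists_lipschitz_deriv {u : ℝ → ℝ} (hu : ContDiff ℝ 2 u) (R : ℝ) :
    ∃ K : ℝ, 0 ≤ K ∧ ∀ a ∈ Icc (-R) R, ∀ b ∈ Icc (-R) R,
      |deriv u a - deriv u b| ≤ K * |a - b| := by
  have h1 : ContDiff ℝ 1 (deriv u) := (contDiff_succ_iff_deriv (n := 1).1 hu).2.2
  obtain ⟨K, hK⟩ := (isCompact_Icc (a := -R) (b := R)).exists_bound_of_continuousOn
    (h1.continuous_deriv le_rfl).continuousOn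
  refine ⟨max K 0, le_max_right _ _, fun a ha b hb => ?_⟩
  exact (convex_Icc (-R) R).norm_image_sub_le_of_norm_deriv_le
    (fun x _ => (h1.differentiable (by norm_num)) x)
    (fun x hx => (hK x hx).trans (le_max_left _ _)) hb ha

/-- The truncated fractional Laplacians of a `C²` function are bounded on bounded sets, uniformly
in the scale of the truncation. -/
theorem exists_bound_truncLap {s : ℝ} (hs : s ∈ Ioo (0 : ℝ) 1) {u : ℝ → ℝ} (hu : ContDiff ℝ 2 u)
    (hint : ∀ v δ : ℝ, 0 < δ → Integrable fun y => (u v - u y) * truncKernel s δ (v - y)) (R : ℝ) :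
    ∃ C : ℝ, ∀ v ∈ Icc (-R) R, ∀ δ > 0, |truncLap s δ u v| ≤ C := by
  rcases lt_or_ge R 0 with hR | hR
  · exact ⟨0, fun v hv => by linarith [hv.1, hv.2]⟩
  obtain ⟨K, hK0, hK⟩ := exists_lipschitz_deriv hu (R + 1)
  obtain ⟨B, hB⟩ := (isCompact_Icc (a := -R) (b := R)).exists_bound_of_continuousOn
    hu.continuous.continuousOn
  have hp : (0 : ℝ) ≤ 1 + 2 * s := by linarith [hs.1]
  have hk1 : Integrable (truncKernel s 1) := integrable_truncKernel hs one_pos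
  -- `G` dominates `|u(y)| |v - y|^{-(1+2s)}` at distance at least `1` from `v`.
  let G : ℝ → ℝ := fun y => (1 + R) ^ (1 + 2 * s) * |(u 0 - u y) * truncKernel s 1 (0 - y)| +
    (Icc (-1 : ℝ) 1).indicator (fun y => |u 0 - u y|) y
  have hG : Integrable G := by
    refine ((hint 0 1 one_pos).abs.const_mul _).add ?_
    rw [integrable_indicator_iff measurableSet_Icc]
    exact (continuous_const.sub hu.continuous).abs.continuousOn.integrableOn_compact isCompact_Icc
  have hGle : ∀ v ∈ Icc (-R) R, ∀ y, |u 0 - u y| * truncKernel s 1 (v - y) ≤ G y := by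
    intro v hv y
    have hv' : |v| ≤ R := abs_le.2 hv
    have hnn : 0 ≤ (1 + R) ^ (1 + 2 * s) * |(u 0 - u y) * truncKernel s 1 (0 - y)| := by positivity
    by_cases hy : y ∈ Icc (-1 : ℝ) 1
    · have h1 : truncKernel s 1 (v - y) ≤ 1 := by
        simpa using truncKernel_le hs.1 one_pos (v - y)
      simp only [G, indicator_of_mem hy]
      nlinarith [abs_nonneg (u 0 - u y)]
    · have hy1 : 1 ≤ |y| := by
        by_contra hcon
        exact hy (abs_le.1 (not_le.1 hcon).le)
      simp only [G, indicator_of_notMem hy, add_zero, abs_mul, zero_sub, truncKernel_neg,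
        abs_of_nonneg (truncKernel_nonneg s 1 y)]
      rw [mul_left_comm]
      refine mul_le_mul_of_nonneg_left ?_ (abs_nonneg _)
      refine indicator_apply_le' (fun h1 => ?_)
        (fun _ => mul_nonneg (by positivity) (truncKernel_nonneg _ _ _))
      have h1 : 1 ≤ |v - y| := h1
      have h2 : truncKernel s 1 y = (|y| ^ (1 + 2 * s))⁻¹ := indicator_of_mem (by exact hy1) _
      have h3 : |y| ≤ (1 + R) * |v - y| := by
        have h4 : |y| ≤ |v| + |v - y| := by
          have := abs_sub v (v - y)
          rwa [sub_sub_cancel] at this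
        nlinarith
      rw [h2, ← div_eq_mul_inv, le_div_iff₀ (by positivity), inv_mul_le_iff₀ (by positivity),
        ← Real.mul_rpow (by positivity) (by positivity), mul_comm (|v - y|)]
      exact Real.rpow_le_rpow (abs_nonneg _) h3 hp
  have hk0 := integrable_min_sq_mul_kernel hs
  refine ⟨(∫ z, 2 * K * (min 1 (z ^ 2) * (|z| ^ (1 + 2 * s))⁻¹)) +
    ((∫ z, (2 * (B + |u 0|)) * truncKernel s 1 z) + 2 * ∫ z, G z), fun v hv δ hδ => ?_⟩
  have hG1 : Integrable fun z => G (v - z) := hG.comp_sub_left v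
  have hG2 : Integrable fun z => G (v + z) := hG.comp_add_left v
  have iN1 := hk0.const_mul (2 * K)
  have iN2 := hk1.const_mul (2 * (B + |u 0|))
  have key := abs_truncLap_le (hint v δ hδ) (iN1.add (iN2.add (hG1.add hG2))) (fun z => ?_)
  · refine key.trans (le_of_eq ?_)
    have e1 := integral_sub_left_eq_self G volume v
    have e2 := integral_add_left_eq_self (μ := volume) G v
    rw [integral_add' iN1 (iN2.add (hG1.add hG2)), integral_add' iN2 (hG1.add hG2),
      integral_add' hG1 hG2, e1, e2]
    ring
  · simp only [Pi.add_apply]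
    have hG0 : ∀ y, 0 ≤ G y := fun y =>
      (mul_nonneg (abs_nonneg _) (truncKernel_nonneg _ _ _)).trans (hGle v hv y)
    have hB0 : 0 ≤ B := (norm_nonneg _).trans (hB v hv)
    have hk1z := truncKernel_nonneg s 1 z
    have hker : (0 : ℝ) ≤ (|z| ^ (1 + 2 * s))⁻¹ := by positivity
    have hmin : (0 : ℝ) ≤ min 1 (z ^ 2) := le_min zero_le_one (sq_nonneg z)
    have hterm : 0 ≤ 2 * (B + |u 0|) * truncKernel s 1 z := by positivity
    have hterm1 : 0 ≤ 2 * K * (min 1 (z ^ 2) * (|z| ^ (1 + 2 * s))⁻¹) := by positivity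
    rcases le_or_gt 1 |z| with hz | hz
    · have e1 : truncKernel s 1 z = (|z| ^ (1 + 2 * s))⁻¹ := indicator_of_mem (by exact hz) _
      have h1 := hGle v hv (v - z)
      have h2 := hGle v hv (v + z)
      rw [sub_sub_cancel] at h1
      rw [sub_add_cancel_left, truncKernel_neg] at h2
      have h3 : |secondDiff u v z| ≤ 2 * (B + |u 0|) + |u 0 - u (v - z)| + |u 0 - u (v + z)| := by
        have hv1 : |u v| ≤ B := hB v hv
        have : secondDiff u v z = 2 * u v - 2 * u 0 + (u 0 - u (v - z)) + (u 0 - u (v + z)) := by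
          simp only [secondDiff]; ring
        rw [this]
        have a1 := abs_add_le (2 * u v - 2 * u 0 + (u 0 - u (v - z))) (u 0 - u (v + z))
        have a2 := abs_add_le (2 * u v - 2 * u 0) (u 0 - u (v - z))
        have a3 := abs_sub (2 * u v) (2 * u 0)
        rw [abs_mul, abs_mul, abs_two] at a3
        linarith
      have h4 : |secondDiff u v z| * truncKernel s δ z ≤
          |secondDiff u v z| * truncKernel s 1 z := by
        rw [e1]
        exact mul_le_mul_of_nonneg_left (truncKernel_le_kernel _ _ _) (abs_nonneg _)
      nlinarith
    · have hz2 : z ^ 2 ≤ 1 := by rw [← sq_abs]; exact pow_le_one₀ (abs_nonneg _) hz.le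
      have hsub : Icc (v - |z|) (v + |z|) ⊆ Icc (-(R + 1)) (R + 1) :=
        Icc_subset_Icc (by linarith [hv.1]) (by linarith [hv.2])
      have h3 := abs_secondDiff_le (hu.differentiable (by norm_num)) (x := v) (h := z)
        (fun a ha b hb => hK a (hsub ha) b (hsub hb)) hK0
      have h4 : |secondDiff u v z| * truncKernel s δ z ≤
          (2 * K * z ^ 2) * (|z| ^ (1 + 2 * s))⁻¹ :=
        mul_le_mul h3 (truncKernel_le_kernel _ _ _) (truncKernel_nonneg _ _ _) (by positivity)
      rw [min_eq_right hz2]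
      have := hG0 (v - z)
      have := hG0 (v + z)
      linarith

theorem measurable_truncLap {s δ : ℝ} {u : ℝ → ℝ} (hu : Measurable u) :
    Measurable (truncLap s δ u) := by
  have h : StronglyMeasurable
      (Function.uncurry fun x y => (u x - u y) * truncKernel s δ (x - y)) := by
    apply Measurable.stronglyMeasurable
    have := measurable_truncKernel s δ
    unfold Function.uncurry
    fun_prop
  exact h.integral_prod_right.measurable

/-! ### Symmetry of the truncated fractional Laplacian -/

theorem integrable_sub_mul_truncKernel {s δ : ℝ} (hs : s ∈ Ioo (0 : ℝ) 1) (hδ : 0 < δ)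
    {e : ℝ → ℝ} (he : Integrable e) (v : ℝ) :
    Integrable fun y => (e v - e y) * truncKernel s δ (v - y) := by
  have hk : Integrable fun y => truncKernel s δ (v - y) :=
    (integrable_truncKernel hs hδ).comp_sub_left v
  have h2 : Integrable fun y => truncKernel s δ (v - y) * e y := by
    refine he.bdd_mul (c := (δ ^ (1 + 2 * s))⁻¹) hk.aestronglyMeasurable (ae_of_all _ fun y => ?_)
    rw [Real.norm_of_nonneg (truncKernel_nonneg _ _ _)]
    exact truncKernel_le hs.1 hδ _
  refine ((hk.const_mul (e v)).sub h2).congr (ae_of_all _ fun y => ?_)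
  simp only [Pi.sub_apply]
  ring

theorem integrable_sub_mul_truncKernel_of_bounded {s δ : ℝ} (hs : s ∈ Ioo (0 : ℝ) 1) (hδ : 0 < δ)
    {β : ℝ → ℝ} (hβ : Measurable β) {B : ℝ} (hB : ∀ v, |β v| ≤ B) (v : ℝ) :
    Integrable fun y => (β v - β y) * truncKernel s δ (v - y) := by
  have hk : Integrable fun y => truncKernel s δ (v - y) :=
    (integrable_truncKernel hs hδ).comp_sub_left v
  refine hk.bdd_mul (c := B + B) (by fun_prop) (ae_of_all _ fun y => ?_)
  exact (abs_sub _ _).trans (add_le_add (hB v) (hB y))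

/-- The truncated fractional Laplacian is symmetric, between integrable functions and bounded
ones. -/
theorem integrable_mul_truncLap_and_integral_comm {s δ : ℝ} (hs : s ∈ Ioo (0 : ℝ) 1) (hδ : 0 < δ)
    {e β : ℝ → ℝ} (he : Integrable e) (hβ : Measurable β) {B : ℝ} (hB : ∀ v, |β v| ≤ B) :
    Integrable (fun v => β v * truncLap s δ e v) ∧
    Integrable (fun v => e v * truncLap s δ β v) ∧
    ∫ v, β v * truncLap s δ e v = ∫ v, e v * truncLap s δ β v := by
  have hk := integrable_truncKernel hs hδ
  -- the kernels `e(w) k(v-w)` and `e(v) k(v-w)` on the plane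
  have i1 : Integrable (fun p : ℝ × ℝ => e p.2 * truncKernel s δ (p.1 - p.2))
      (volume.prod volume) :=
    Integrable.convolution_integrand (ContinuousLinearMap.mul ℝ ℝ) he hk
  have i2 : Integrable (fun p : ℝ × ℝ => e p.1 * truncKernel s δ (p.1 - p.2))
      (volume.prod volume) := by
    refine i1.swap.congr (ae_of_all _ fun p => ?_)
    simp only [Function.comp, Prod.fst_swap, Prod.snd_swap]
    rw [truncKernel_sub_comm]
  have b1 : ∀ {F : ℝ × ℝ → ℝ}, Integrable F (volume.prod volume) →
      Integrable (fun p => β p.1 * F p) (volume.prod volume) := fun hF =>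
    hF.bdd_mul (c := B) (hβ.comp measurable_fst).aestronglyMeasurable
      (ae_of_all _ fun p => hB p.1)
  have b2 : ∀ {F : ℝ × ℝ → ℝ}, Integrable F (volume.prod volume) →
      Integrable (fun p => β p.2 * F p) (volume.prod volume) := fun hF =>
    hF.bdd_mul (c := B) (hβ.comp measurable_snd).aestronglyMeasurable
      (ae_of_all _ fun p => hB p.2)
  have j1 := b1 i1
  have j2 := b1 i2
  have j3 := b2 i2
  have hL : ∀ v, ∫ w, (β v * (e v * truncKernel s δ (v - w)) -
      β v * (e w * truncKernel s δ (v - w))) = β v * truncLap s δ e v := by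
    intro v
    rw [truncLap, ← integral_const_mul]
    congr 1; ext w; ring
  have hR : ∀ v, ∫ w, (β v * (e v * truncKernel s δ (v - w)) -
      β w * (e v * truncKernel s δ (v - w))) = e v * truncLap s δ β v := by
    intro v
    rw [truncLap, ← integral_const_mul]
    congr 1; ext w; ring
  refine ⟨(j2.sub j1).integral_prod_left.congr (ae_of_all _ hL),
    (j2.sub j3).integral_prod_left.congr (ae_of_all _ hR), ?_⟩
  rw [← integral_congr_ae (ae_of_all _ hL), ← integral_congr_ae (ae_of_all _ hR),
    ← integral_prod (fun p : ℝ × ℝ => β p.1 * (e p.1 * truncKernel s δ (p.1 - p.2)) -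
      β p.1 * (e p.2 * truncKernel s δ (p.1 - p.2))) (j2.sub j1),
    ← integral_prod (fun p : ℝ × ℝ => β p.1 * (e p.1 * truncKernel s δ (p.1 - p.2)) -
      β p.2 * (e p.1 * truncKernel s δ (p.1 - p.2))) (j2.sub j3),
    integral_sub j2 j1, integral_sub j2 j3]
  congr 1
  rw [← integral_prod_swap]
  congr 1; ext p
  simp only [Prod.fst_swap, Prod.snd_swap]
  rw [truncKernel_sub_comm]

/-! ### Cutoff functions -/

/-- A fixed smooth cutoff, equal to `1` on `[-1, 1]` and to `0` outside `(-2, 2)`. -/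
def bump : ContDiffBump (0 : ℝ) := ⟨1, 2, one_pos, one_lt_two⟩

/-- The cutoff at scale `R`, equal to `1` on `[-R, R]` and to `0` outside `(-2R, 2R)`. -/
def cutoff (R v : ℝ) : ℝ := bump (R⁻¹ * v)

theorem cutoff_contDiff (R : ℝ) : ContDiff ℝ 2 (cutoff R) :=
  bump.contDiff.comp (contDiff_const.mul contDiff_id)

theorem cutoff_nonneg (R v : ℝ) : 0 ≤ cutoff R v := bump.nonneg

theorem cutoff_le_one (R v : ℝ) : cutoff R v ≤ 1 := bump.le_one

theorem abs_cutoff_le_one (R v : ℝ) : |cutoff R v| ≤ 1 := by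
  rw [abs_of_nonneg (cutoff_nonneg R v)]; exact cutoff_le_one R v

theorem cutoff_eq_one {R v : ℝ} (hR : 0 < R) (hv : |v| ≤ R) : cutoff R v = 1 := by
  refine bump.one_of_mem_closedBall ?_
  rw [mem_closedBall_zero_iff, Real.norm_eq_abs, abs_mul, abs_inv, abs_of_pos hR]
  exact (inv_mul_le_iff₀ hR).2 (by simpa [bump] using hv)

theorem cutoff_eq_zero {R v : ℝ} (hR : 0 < R) (hv : 2 * R ≤ |v|) : cutoff R v = 0 := by
  refine bump.zero_of_le_dist ?_
  rw [dist_zero_right, Real.norm_eq_abs, abs_mul, abs_inv, abs_of_pos hR]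
  exact (le_inv_mul_iff₀ hR).2 (by simp only [bump]; linarith)

theorem tsupport_cutoff_subset {R : ℝ} (hR : 0 < R) :
    tsupport (cutoff R) ⊆ Icc (-(2 * R)) (2 * R) := by
  refine closure_minimal (fun v hv => ?_) isClosed_Icc
  by_contra hcon
  refine hv (cutoff_eq_zero hR ?_)
  by_contra h2
  exact hcon (abs_le.1 (not_le.1 h2).le)

theorem hasCompactSupport_cutoff {R : ℝ} (hR : 0 < R) : HasCompactSupport (cutoff R) :=
  isCompact_Icc.of_isClosed_subset (isClosed_tsupport _) (tsupport_cutoff_subset hR)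

theorem deriv_cutoff (R v : ℝ) : deriv (cutoff R) v = R⁻¹ * deriv bump (R⁻¹ * v) := by
  have := deriv_comp_mul_left R⁻¹ (bump : ℝ → ℝ) v
  simpa [cutoff, Function.comp_def] using! this

theorem deriv_cutoff_eq_zero {R v : ℝ} (hR : 0 < R) (hv : |v| < R) : deriv (cutoff R) v = 0 := by
  have h : cutoff R =ᶠ[𝓝 v] fun _ => 1 := by
    filter_upwards [(isOpen_lt continuous_abs continuous_const).mem_nhds hv] with w hw
    exact cutoff_eq_one hR (le_of_lt hw)
  rw [h.deriv_eq, deriv_const]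

/-- The second bound controls the drift term: it is uniform in `R`, and vanishes on `(-R, R)`. -/
theorem exists_bound_deriv_cutoff : ∃ C : ℝ, 0 ≤ C ∧ ∀ R > 0, ∀ v,
    |deriv (cutoff R) v| ≤ C / R ∧
      |v * deriv (cutoff R) v| ≤ {v : ℝ | R ≤ |v|}.indicator (fun _ => C) v := by
  obtain ⟨C, hC⟩ := bump.hasCompactSupport.deriv.exists_bound_of_continuous
    ((bump.contDiff (n := 1)).continuous_deriv le_rfl)
  have hC0 : 0 ≤ C := (norm_nonneg _).trans (hC 0)
  have h1 : ∀ R > 0, ∀ v, |deriv (cutoff R) v| ≤ C / R := by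
    intro R hR v
    rw [deriv_cutoff, abs_mul, abs_inv, abs_of_pos hR, inv_mul_eq_div]
    gcongr
    exact hC _
  refine ⟨2 * C, by positivity, fun R hR v => ⟨(h1 R hR v).trans (by gcongr; linarith), ?_⟩⟩
  by_cases hv : R ≤ |v|
  · rw [indicator_of_mem (by exact hv)]
    by_cases hv2 : |v| ≤ 2 * R
    · rw [abs_mul]
      calc |v| * |deriv (cutoff R) v| ≤ (2 * R) * (C / R) :=
            mul_le_mul hv2 (h1 R hR v) (abs_nonneg _) (by positivity)
        _ = 2 * C := by field_simp
    · have : deriv (cutoff R) v = 0 := by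
        by_contra hcon
        exact hv2 (abs_le.2 (tsupport_cutoff_subset hR (support_deriv_subset hcon)))
      rw [this, mul_zero, abs_zero]; positivity
  · rw [indicator_of_notMem (by exact hv), deriv_cutoff_eq_zero hR (not_le.1 hv)]
    simp

/-- The fractional Laplacian of the cutoff at scale `R` tends to zero uniformly as `R → ∞`. -/
theorem exists_bound_truncLap_cutoff {s : ℝ} (hs : s ∈ Ioo (0 : ℝ) 1) : ∃ Λ : ℝ → ℝ,
    Tendsto Λ atTop (𝓝 0) ∧ ∀ R > 0, ∀ δ > 0, ∀ v, |truncLap s δ (cutoff R) v| ≤ Λ R := by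
  have hb : ContDiff ℝ 2 (bump : ℝ → ℝ) := bump.contDiff
  have hd1 : ContDiff ℝ 1 (deriv bump) := (contDiff_succ_iff_deriv (n := 1).1 hb).2.2
  obtain ⟨K, hK⟩ := bump.hasCompactSupport.deriv.deriv.exists_bound_of_continuous
    (hd1.continuous_deriv le_rfl)
  have hK0 : 0 ≤ K := (norm_nonneg _).trans (hK 0)
  have hlip : ∀ a b, |deriv bump a - deriv bump b| ≤ K * |a - b| := fun a b =>
    convex_univ.norm_image_sub_le_of_norm_deriv_le
      (fun x _ => (hd1.differentiable (by norm_num)) x) (fun x _ => hK x) (mem_univ b) (mem_univ a)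
  have hsd : ∀ R > 0, ∀ v z, |secondDiff (cutoff R) v z| ≤ (4 + 2 * K) * min 1 ((R⁻¹ * z) ^ 2) := by
    intro R hR v z
    have e : secondDiff (cutoff R) v z = secondDiff bump (R⁻¹ * v) (R⁻¹ * z) := by
      simp only [secondDiff, cutoff, mul_add, mul_sub]
    have h1 := abs_secondDiff_le (hb.differentiable (by norm_num)) (x := R⁻¹ * v) (h := R⁻¹ * z)
      (fun a _ b _ => hlip a b) hK0
    have h2 : |secondDiff (cutoff R) v z| ≤ 4 := by
      have n1 := cutoff_nonneg R v
      have n2 := cutoff_nonneg R (v + z)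
      have n3 := cutoff_nonneg R (v - z)
      have l1 := cutoff_le_one R v
      have l2 := cutoff_le_one R (v + z)
      have l3 := cutoff_le_one R (v - z)
      rw [secondDiff, abs_le]
      constructor <;> linarith
    rw [← e] at h1
    rcases min_cases 1 ((R⁻¹ * z) ^ 2) with ⟨h, -⟩ | ⟨h, -⟩ <;> rw [h]
    · linarith
    · nlinarith [sq_nonneg (R⁻¹ * z)]
  have hmeas : ∀ R : ℝ, Measurable fun z : ℝ =>
      (4 + 2 * K) * min 1 ((R⁻¹ * z) ^ 2) * (|z| ^ (1 + 2 * s))⁻¹ := fun R => by fun_prop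
  have hk0 := (integrable_min_sq_mul_kernel hs).const_mul (4 + 2 * K)
  have hdom : ∀ R ≥ 1, ∀ z : ℝ, ‖(4 + 2 * K) * min 1 ((R⁻¹ * z) ^ 2) * (|z| ^ (1 + 2 * s))⁻¹‖ ≤
      (4 + 2 * K) * (min 1 (z ^ 2) * (|z| ^ (1 + 2 * s))⁻¹) := by
    intro R hR z
    have hm : 0 ≤ min 1 ((R⁻¹ * z) ^ 2) := le_min zero_le_one (sq_nonneg _)
    rw [Real.norm_of_nonneg (by positivity), mul_assoc]
    gcongr (4 + 2 * K) * (min 1 ?_ * _)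
    rw [mul_pow]
    refine mul_le_of_le_one_left (sq_nonneg z)
      (pow_le_one₀ (by positivity) (inv_le_one_of_one_le₀ hR))
  refine ⟨fun R => ∫ z, (4 + 2 * K) * min 1 ((R⁻¹ * z) ^ 2) * (|z| ^ (1 + 2 * s))⁻¹, ?_, ?_⟩
  · have := tendsto_integral_filter_of_dominated_convergence (l := atTop) (μ := volume)
      (F := fun (R z : ℝ) => (4 + 2 * K) * min 1 ((R⁻¹ * z) ^ 2) * (|z| ^ (1 + 2 * s))⁻¹)
      (f := fun _ => 0) _ (Eventually.of_forall fun R => (hmeas R).aestronglyMeasurable)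
      ((eventually_ge_atTop 1).mono fun R hR => ae_of_all _ (hdom R hR)) hk0
      (ae_of_all _ fun z => ?_)
    · simpa using this
    · have h1 : Tendsto (fun R : ℝ => (R⁻¹ * z) ^ 2) atTop (𝓝 0) := by
        simpa using (tendsto_inv_atTop_zero.mul_const z).pow 2
      have h2 : Tendsto (fun R : ℝ => min 1 ((R⁻¹ * z) ^ 2)) atTop (𝓝 0) := by
        simpa using (tendsto_const_nhds (x := (1 : ℝ))).min h1
      simpa using (h2.const_mul (4 + 2 * K)).mul_const ((|z| ^ (1 + 2 * s))⁻¹)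
  · intro R hR δ hδ v
    refine abs_truncLap_le (integrable_sub_mul_truncKernel_of_bounded hs hδ
      (cutoff_contDiff R).continuous.measurable (abs_cutoff_le_one R) v) ?_ (fun z => ?_)
    · refine (hk0.const_mul (1 + (R ^ 2)⁻¹)).mono' (hmeas R).aestronglyMeasurable
        (ae_of_all _ fun z => ?_)
      have hm : 0 ≤ min 1 ((R⁻¹ * z) ^ 2) := le_min zero_le_one (sq_nonneg _)
      rw [Real.norm_of_nonneg (by positivity), mul_assoc, mul_left_comm (1 + (R ^ 2)⁻¹),
        ← mul_assoc (1 + (R ^ 2)⁻¹)]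
      gcongr (4 + 2 * K) * (?_ * _)
      have h0 : 0 ≤ (R ^ 2)⁻¹ := by positivity
      rw [mul_pow, inv_pow]
      rcases min_cases 1 (z ^ 2) with ⟨h, -⟩ | ⟨h, -⟩ <;> rw [h]
      · exact (min_le_left _ _).trans (by linarith)
      · exact (min_le_right _ _).trans (by nlinarith [sq_nonneg z])
    · exact mul_le_mul (hsd R hR v z) (truncKernel_le_kernel _ _ _) (truncKernel_nonneg _ _ _)
        (mul_nonneg (by positivity) (le_min zero_le_one (sq_nonneg _)))

/-! ### The entropy inequality in the velocity variable -/

/-- Pointwise convexity inequality: `f²/m` is a subsolution whenever `f` is a solution. With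
`F = f(v)/m(v)` it rests on `2 F f(w) - F² m(w) ≤ f(w)²/m(w)`. -/
theorem truncLap_quotient_le {s δ : ℝ} (hs : s ∈ Ioo (0 : ℝ) 1) (hδ : 0 < δ) {m f : ℝ → ℝ}
    (hm : ∀ v, 0 < m v) {v : ℝ}
    (hmi : Integrable fun y => (m v - m y) * truncKernel s δ (v - y))
    (hfi : Integrable fun y => (f v - f y) * truncKernel s δ (v - y))
    (he : Integrable fun v => f v ^ 2 / m v) :
    (f v / m v) ^ 2 * truncLap s δ m v - 2 * (f v / m v) * truncLap s δ f v ≤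
      -truncLap s δ (fun v => f v ^ 2 / m v) v := by
  have hei := integrable_sub_mul_truncKernel hs hδ he v
  simp only [truncLap]
  rw [← integral_const_mul, ← integral_const_mul,
    ← integral_sub (hmi.const_mul _) (hfi.const_mul _), ← integral_neg]
  refine integral_mono ((hmi.const_mul _).sub (hfi.const_mul _)) hei.neg fun w => ?_
  have hk := truncKernel_nonneg s δ (v - w)
  have hmv := hm v
  have hmw := hm w
  have key : (f v / m v) ^ 2 * (m v - m w) - 2 * (f v / m v) * (f v - f w) ≤
      -(f v ^ 2 / m v - f w ^ 2 / m w) := by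
    have e : -(f v ^ 2 / m v - f w ^ 2 / m w) -
        ((f v / m v) ^ 2 * (m v - m w) - 2 * (f v / m v) * (f v - f w)) =
        m w * (f w / m w - f v / m v) ^ 2 := by
      field_simp
      ring
    have : 0 ≤ m w * (f w / m w - f v / m v) ^ 2 := by positivity
    linarith
  nlinarith

/-- The weak form of the entropy inequality. Here `m` is a stationary state, `P` is the rate of
change `2 (f/m) (κ ∂_v(v f) - (-Δ)^s f)` of `f²/m`, and `β` is a nonnegative test function whose
truncated fractional Laplacians are at most `Λ`. -/
theorem integral_mul_production_le {s κ : ℝ} (hs : s ∈ Ioo (0 : ℝ) 1) (hκ : 0 ≤ κ)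
    {m f β P : ℝ → ℝ} (hm2 : ContDiff ℝ 2 m) (hm : ∀ v, 0 < m v)
    (hmL : ∀ v, HasFracLaplacian s m v (κ * deriv (fun w => w * m w) v))
    (hf2 : ContDiff ℝ 2 f)
    (hfL : ∀ v, ∃ l, HasFracLaplacian s f v l ∧
      P v = 2 * (f v / m v) * (κ * deriv (fun w => w * f w) v - l))
    (hP : Continuous P) (he : Integrable fun v => f v ^ 2 / m v)
    (hβ2 : ContDiff ℝ 2 β) (hβc : HasCompactSupport β) (hβ0 : ∀ v, 0 ≤ β v)
    {Λ : ℝ} (hΛ : ∀ δ > 0, ∀ v, |truncLap s δ β v| ≤ Λ) :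
    ∫ v, β v * P v ≤
      ∫ v, (κ * |v * deriv β v| + fracLapConst s * Λ) * (f v ^ 2 / m v) := by
  have hC := fracLapConst_nonneg hs
  set c := fracLapConst s with hc
  set e : ℝ → ℝ := fun v => f v ^ 2 / m v with hedef
  have hmd : Differentiable ℝ m := hm2.differentiable (by norm_num)
  have hfd : Differentiable ℝ f := hf2.differentiable (by norm_num)
  have he2 : ContDiff ℝ 2 e := (hf2.pow 2).div hm2 fun v => (hm v).ne'
  have hed : Differentiable ℝ e := he2.differentiable (by norm_num)
  have hβd : Differentiable ℝ β := hβ2.differentiable (by norm_num)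
  have hde : Continuous (deriv e) := he2.continuous_deriv (by norm_num)
  have hdβ : Continuous (deriv β) := hβ2.continuous_deriv (by norm_num)
  have he0 : ∀ v, 0 ≤ e v := fun v => div_nonneg (sq_nonneg _) (hm v).le
  have hdw : ∀ {u : ℝ → ℝ}, Differentiable ℝ u → ∀ v, HasDerivAt (fun w => w * u w)
      (u v + v * deriv u v) v := by
    intro u hu v
    simpa using! (hasDerivAt_id v).mul (hu v).hasDerivAt
  have hed' : ∀ v, deriv e v = 2 * (f v / m v) * deriv f v - (f v / m v) ^ 2 * deriv m v := by
    intro v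
    have h1 : HasDerivAt e ((2 * f v * deriv f v * m v - f v ^ 2 * deriv m v) / m v ^ 2) v := by
      have := ((hfd v).hasDerivAt.pow 2).div (hmd v).hasDerivAt (hm v).ne'
      simpa using! this
    rw [h1.deriv]
    have := (hm v).ne'
    field_simp
  -- The local part of the production is the drift of `e`; the rest is the nonlocal part `Q`.
  let Q : ℝ → ℝ := fun v => P v - κ * (e v + v * deriv e v)
  have hQ : Continuous Q := by
    have := he2.continuous
    fun_prop
  let Qδ : ℝ → ℝ → ℝ := fun δ v =>
    c * ((f v / m v) ^ 2 * truncLap s δ m v - 2 * (f v / m v) * truncLap s δ f v)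
  have hQlim : ∀ v, Tendsto (fun δ => Qδ δ v) (𝓝[>] 0) (𝓝 (Q v)) := by
    intro v
    obtain ⟨l, hl, hPl⟩ := hfL v
    have h1 := ((hmL v).tendsto.const_mul ((f v / m v) ^ 2)).sub
      (hl.tendsto.const_mul (2 * (f v / m v)))
    have e1 : Q v = (f v / m v) ^ 2 * (κ * deriv (fun w => w * m w) v) - 2 * (f v / m v) * l := by
      simp only [Q]
      rw [hPl, hed', (hdw hmd v).deriv, (hdw hfd v).deriv]
      simp only [hedef]
      have := (hm v).ne'
      field_simp
      ring
    rw [e1]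
    refine h1.congr fun δ => ?_
    simp only [Qδ]
    ring
  have hfi : ∀ v δ : ℝ, 0 < δ → Integrable fun y => (f v - f y) * truncKernel s δ (v - y) :=
    fun v δ hδ => (hfL v).choose_spec.1.integrable hδ
  have hmi : ∀ v δ : ℝ, 0 < δ → Integrable fun y => (m v - m y) * truncKernel s δ (v - y) :=
    fun v δ hδ => (hmL v).integrable hδ
  obtain ⟨B, hB⟩ := hβc.exists_bound_of_continuous hβ2.continuous
  have hsymm := fun δ (hδ : 0 < δ) =>
    integrable_mul_truncLap_and_integral_comm hs hδ he hβ2.continuous.measurable hB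
  -- the bound on the nonlocal part at a positive truncation scale
  obtain ⟨R, hR0, hR⟩ : ∃ R : ℝ, 0 ≤ R ∧ ∀ v, v ∉ Icc (-R) R → β v = 0 := by
    obtain ⟨R, hR⟩ := hβc.isCompact.isBounded.subset_closedBall 0
    refine ⟨max R 0, le_max_right _ _, fun v hv => ?_⟩
    by_contra hcon
    have := hR (subset_tsupport β hcon)
    rw [mem_closedBall_zero_iff, Real.norm_eq_abs] at this
    exact hv (abs_le.1 (this.trans (le_max_left _ _)))
  obtain ⟨Cm, hCm⟩ := exists_bound_truncLap hs hm2 hmi R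
  obtain ⟨Cf, hCf⟩ := exists_bound_truncLap hs hf2 hfi R
  have hfm : Continuous fun v => f v / m v := hf2.continuous.div hm2.continuous fun v => (hm v).ne'
  have hmeas : ∀ δ, Measurable fun v => β v * Qδ δ v := by
    intro δ
    have h1 := measurable_truncLap (s := s) (δ := δ) hm2.continuous.measurable
    have h2 := measurable_truncLap (s := s) (δ := δ) hf2.continuous.measurable
    have h3 := hfm.measurable
    have h4 := hβ2.continuous.measurable
    simp only [Qδ]
    fun_prop
  let D : ℝ → ℝ := fun v => β v * (c * ((f v / m v) ^ 2 * |Cm| + 2 * |f v / m v| * |Cf|))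
  have hDc : Continuous D := by
    have := hβ2.continuous
    fun_prop
  have hD : Integrable D := hDc.integrable_of_hasCompactSupport hβc.mul_right
  have hdom : ∀ δ > 0, ∀ v, ‖β v * Qδ δ v‖ ≤ D v := by
    intro δ hδ v
    by_cases hv : v ∈ Icc (-R) R
    · rw [Real.norm_eq_abs, abs_mul, abs_of_nonneg (hβ0 v)]
      refine mul_le_mul_of_nonneg_left ?_ (hβ0 v)
      rw [abs_mul, abs_of_nonneg hC]
      refine mul_le_mul_of_nonneg_left ((abs_sub _ _).trans ?_) hC
      rw [abs_mul, abs_mul, abs_mul, abs_two, abs_of_nonneg (sq_nonneg (f v / m v))]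
      have h1 := (hCm v hv δ hδ).trans (le_abs_self Cm)
      have h2 := (hCf v hv δ hδ).trans (le_abs_self Cf)
      gcongr
    · simp [D, hR v hv]
  have hQi : ∀ δ > 0, Integrable fun v => β v * Qδ δ v := fun δ hδ =>
    hD.mono' (hmeas δ).aestronglyMeasurable (ae_of_all _ (hdom δ hδ))
  have hstep : ∀ δ > 0, ∫ v, β v * Qδ δ v ≤ c * Λ * ∫ v, e v := by
    intro δ hδ
    obtain ⟨i1, i2, i3⟩ := hsymm δ hδ
    calc ∫ v, β v * Qδ δ v ≤ ∫ v, -c * (β v * truncLap s δ e v) := by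
          refine integral_mono (hQi δ hδ) (i1.const_mul _) fun v => ?_
          have h1 := truncLap_quotient_le hs hδ hm (hmi v δ hδ) (hfi v δ hδ) he
          have h2 := mul_le_mul_of_nonneg_left h1 (mul_nonneg (hβ0 v) hC)
          simp only [Qδ]
          linarith
      _ = ∫ v, -c * (e v * truncLap s δ β v) := by
          rw [integral_const_mul, integral_const_mul, i3]
      _ ≤ ∫ v, c * Λ * e v := by
          refine integral_mono (i2.const_mul _) (he.const_mul _) fun v => ?_
          have h1 := (abs_le.1 (hΛ δ hδ v)).1
          have h2 := mul_nonneg hC (he0 v)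
          have h3 := mul_le_mul_of_nonneg_left h1 h2
          simp only
          linarith
      _ = c * Λ * ∫ v, e v := integral_const_mul _ _
  have hQfinal : ∫ v, β v * Q v ≤ c * Λ * ∫ v, e v := by
    refine le_of_tendsto (tendsto_integral_filter_of_dominated_convergence (l := 𝓝[>] (0 : ℝ)) D
      (Eventually.of_forall fun δ => (hmeas δ).aestronglyMeasurable) ?_ hD
      (ae_of_all _ fun v => (hQlim v).const_mul (β v))) ?_
    · filter_upwards [self_mem_nhdsWithin] with δ hδ
      exact ae_of_all _ (hdom δ hδ)
    · filter_upwards [self_mem_nhdsWithin] with δ hδ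
      exact hstep δ hδ
  -- integration by parts in the drift
  have hec := he2.continuous
  have hβcont := hβ2.continuous
  have j1 : Integrable fun v => β v * (e v + v * deriv e v) :=
    Continuous.integrable_of_hasCompactSupport (by fun_prop) hβc.mul_right
  have j2 : Integrable fun v => deriv β v * (v * e v) :=
    Continuous.integrable_of_hasCompactSupport (by fun_prop) hβc.deriv.mul_right
  have j3 : Integrable fun v => β v * (v * e v) :=
    Continuous.integrable_of_hasCompactSupport (by fun_prop) hβc.mul_right
  have hibp : ∫ v, β v * (e v + v * deriv e v) = -∫ v, deriv β v * (v * e v) :=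
    integral_mul_deriv_eq_deriv_mul_of_integrable (fun v _ => (hβd v).hasDerivAt)
      (fun v _ => hdw hed v) j1 j2 j3
  have j4 : Integrable fun v => β v * Q v :=
    Continuous.integrable_of_hasCompactSupport (by fun_prop) hβc.mul_right
  have j5 : Integrable fun v => κ * |v * deriv β v| * e v := by
    refine Continuous.integrable_of_hasCompactSupport (by fun_prop) ?_
    have h := (hβc.deriv.mul_left (f := fun v : ℝ => v)).norm.mul_left (f := fun _ : ℝ => κ)
    exact h.mul_right (f' := e)
  calc ∫ v, β v * P v = ∫ v, (κ * (β v * (e v + v * deriv e v)) + β v * Q v) := by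
        congr 1; ext v; simp only [Q]; ring
    _ = κ * (∫ v, -(deriv β v * (v * e v))) + ∫ v, β v * Q v := by
        rw [integral_add (j1.const_mul κ) j4, integral_const_mul, hibp, integral_neg]
    _ ≤ (∫ v, κ * |v * deriv β v| * e v) + c * Λ * ∫ v, e v := by
        refine add_le_add ?_ hQfinal
        rw [← integral_const_mul]
        refine integral_mono (j2.neg.const_mul κ) j5 fun v => ?_
        have h1 : -(v * deriv β v) ≤ |v * deriv β v| := neg_le_abs _
        have h2 := mul_le_mul_of_nonneg_left h1 (mul_nonneg hκ (he0 v))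
        simp only
        linarith
    _ = ∫ v, (κ * |v * deriv β v| + c * Λ) * e v := by
        rw [← integral_const_mul, ← integral_add j5 (he.const_mul _)]
        congr 1; ext v; ring

/-! ### Finite-energy solutions of the kinetic equation -/

/-- A finite-energy classical solution of `a ∂_t u + b v ∂_x u = κ ∂_v(v u) - (-Δ_v)^s u`, with
energy measured against the weight `1 / m`. The kinetic Lévy-Fokker-Planck equation has `κ = 1`;
the fractional heat equation has `a = 1`, `b = κ = 0`. -/
structure IsKineticSolution (s a b κ : ℝ) (m : ℝ → ℝ) (u : ℝ → ℝ → ℝ → ℝ) : Prop where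
  contDiffOn :
    ContDiffOn ℝ 2 (fun p : ℝ × ℝ × ℝ => u p.1 p.2.1 p.2.2) (Ioi (0 : ℝ) ×ˢ univ)
  equation : ∀ t : ℝ, 0 < t → ∀ x v : ℝ, ∃ l : ℝ, HasFracLaplacian s (u t x) v l ∧
    a * deriv (fun τ => u τ x v) t + b * v * deriv (fun y => u t y v) x
      = κ * deriv (fun w => w * u t x w) v - l
  energy : ∀ T : ℝ, ∫⁻ t in Ioo 0 T, kineticEnergySq m (u t) < ∞

/-- The product cutoff, at scale `R` in velocity and `R²` in space. The larger spatial scale makes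
the transport term, of size `R / R²` on the support, negligible. -/
def phaseCutoff (R : ℝ) (p : ℝ × ℝ) : ℝ := cutoff (R ^ 2) p.1 * cutoff R p.2

theorem continuous_phaseCutoff (R : ℝ) : Continuous (phaseCutoff R) :=
  ((cutoff_contDiff _).continuous.comp continuous_fst).mul
    ((cutoff_contDiff _).continuous.comp continuous_snd)

theorem phaseCutoff_nonneg (R : ℝ) (p : ℝ × ℝ) : 0 ≤ phaseCutoff R p :=
  mul_nonneg (cutoff_nonneg _ _) (cutoff_nonneg _ _)

theorem phaseCutoff_le_one (R : ℝ) (p : ℝ × ℝ) : phaseCutoff R p ≤ 1 :=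
  mul_le_one₀ (cutoff_le_one _ _) (cutoff_nonneg _ _) (cutoff_le_one _ _)

/-- A box containing the support of the phase space cutoff. -/
def phaseBox (R : ℝ) : Set (ℝ × ℝ) :=
  Icc (-(2 * R ^ 2)) (2 * R ^ 2) ×ˢ Icc (-(2 * R ^ 2)) (2 * R ^ 2)

theorem isCompact_phaseBox (R : ℝ) : IsCompact (phaseBox R) := isCompact_Icc.prod isCompact_Icc

theorem cutoff_eq_zero_of_notMem {R S x : ℝ} (hR : 0 < R) (hS : 2 * R ≤ S)
    (hx : x ∉ Icc (-S) S) : cutoff R x = 0 := by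
  refine cutoff_eq_zero hR (hS.trans ?_)
  by_contra hcon
  exact hx (abs_le.1 (not_le.1 hcon).le)

theorem mul_eq_zero_of_notMem_phaseBox {α β : ℝ → ℝ} {R : ℝ}
    (hα : ∀ x ∉ Icc (-(2 * R ^ 2)) (2 * R ^ 2), α x = 0)
    (hβ : ∀ x ∉ Icc (-(2 * R ^ 2)) (2 * R ^ 2), β x = 0) {p : ℝ × ℝ} (hp : p ∉ phaseBox R) :
    α p.1 * β p.2 = 0 := by
  by_cases h1 : p.1 ∈ Icc (-(2 * R ^ 2)) (2 * R ^ 2)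
  · have h2 : p.2 ∉ Icc (-(2 * R ^ 2)) (2 * R ^ 2) := fun h2 => hp ⟨h1, h2⟩
    rw [hβ _ h2, mul_zero]
  · rw [hα _ h1, zero_mul]

theorem cutoff_eq_zero_of_notMem_Icc {R : ℝ} (hR : 1 ≤ R) {x : ℝ}
    (hx : x ∉ Icc (-(2 * R ^ 2)) (2 * R ^ 2)) : cutoff R x = 0 :=
  cutoff_eq_zero_of_notMem (by linarith) (by nlinarith) hx

theorem cutoff_sq_eq_zero_of_notMem_Icc {R : ℝ} (hR : 1 ≤ R) {x : ℝ}
    (hx : x ∉ Icc (-(2 * R ^ 2)) (2 * R ^ 2)) : cutoff (R ^ 2) x = 0 :=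
  cutoff_eq_zero_of_notMem (by positivity) le_rfl hx

theorem phaseCutoff_eq_zero {R : ℝ} (hR : 1 ≤ R) {p : ℝ × ℝ} (hp : p ∉ phaseBox R) :
    phaseCutoff R p = 0 :=
  mul_eq_zero_of_notMem_phaseBox (fun _ => cutoff_sq_eq_zero_of_notMem_Icc hR)
    (fun _ => cutoff_eq_zero_of_notMem_Icc hR) hp

theorem integrable_of_phaseBox {F : ℝ × ℝ → ℝ} (hF : Continuous F) {R : ℝ}
    (h0 : ∀ p ∉ phaseBox R, F p = 0) : Integrable F :=
  hF.integrable_of_hasCompactSupport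
    (HasCompactSupport.intro (isCompact_phaseBox R) fun p hp => h0 p hp)

theorem phaseCutoff_eventually_eq_one (p : ℝ × ℝ) : ∀ᶠ R : ℝ in atTop, phaseCutoff R p = 1 := by
  filter_upwards [eventually_ge_atTop 1, eventually_ge_atTop |p.1|, eventually_ge_atTop |p.2|]
    with R h1 h2 h3
  rw [phaseCutoff, cutoff_eq_one (by positivity) (h2.trans (by nlinarith)),
    cutoff_eq_one (by linarith) h3, one_mul]

theorem isOpen_Ioi_prod_univ : IsOpen (Ioi (0 : ℝ) ×ˢ (univ : Set (ℝ × ℝ))) :=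
  isOpen_Ioi.prod isOpen_univ

/-- A `C²` function of `(t, x, v)`, `t > 0`, has continuous partial derivatives in `t` and `x`. -/
theorem exists_partial_derivs {E : ℝ → ℝ → ℝ → ℝ}
    (hE : ContDiffOn ℝ 2 (fun p : ℝ × ℝ × ℝ => E p.1 p.2.1 p.2.2) (Ioi (0 : ℝ) ×ˢ univ)) :
    ∃ Et Ex : ℝ × ℝ × ℝ → ℝ, ContinuousOn Et (Ioi (0 : ℝ) ×ˢ univ) ∧
      ContinuousOn Ex (Ioi (0 : ℝ) ×ˢ univ) ∧
      ∀ t > 0, ∀ x v, HasDerivAt (fun τ => E τ x v) (Et (t, x, v)) t ∧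
        HasDerivAt (fun y => E t y v) (Ex (t, x, v)) x := by
  have hc := hE.continuousOn_fderiv_of_isOpen isOpen_Ioi_prod_univ (by norm_num)
  refine ⟨fun p => fderiv ℝ (fun p : ℝ × ℝ × ℝ => E p.1 p.2.1 p.2.2) p (1, 0, 0),
    fun p => fderiv ℝ (fun p : ℝ × ℝ × ℝ => E p.1 p.2.1 p.2.2) p (0, 1, 0),
    hc.clm_apply continuousOn_const, hc.clm_apply continuousOn_const, fun t ht x v => ?_⟩
  have hd : HasFDerivAt (fun p : ℝ × ℝ × ℝ => E p.1 p.2.1 p.2.2)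
      (fderiv ℝ (fun p : ℝ × ℝ × ℝ => E p.1 p.2.1 p.2.2) (t, x, v)) (t, x, v) :=
    ((hE.contDiffAt (isOpen_Ioi_prod_univ.mem_nhds (mk_mem_prod ht (mem_univ _)))).differentiableAt
      (by norm_num)).hasFDerivAt
  constructor
  · have h1 : HasDerivAt (fun τ : ℝ => (τ, x, v)) ((1 : ℝ), (0 : ℝ), (0 : ℝ)) t :=
      (hasDerivAt_id t).prodMk ((hasDerivAt_const t x).prodMk (hasDerivAt_const t v))
    exact hd.comp_hasDerivAt t h1
  · have h1 : HasDerivAt (fun y : ℝ => (t, y, v)) ((0 : ℝ), (1 : ℝ), (0 : ℝ)) x :=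
      (hasDerivAt_const x t).prodMk ((hasDerivAt_id x).prodMk (hasDerivAt_const x v))
    exact hd.comp_hasDerivAt x h1

theorem contDiff_slice {E : ℝ → ℝ → ℝ → ℝ}
    (hE : ContDiffOn ℝ 2 (fun p : ℝ × ℝ × ℝ => E p.1 p.2.1 p.2.2) (Ioi (0 : ℝ) ×ˢ univ))
    {t : ℝ} (ht : 0 < t) : ContDiff ℝ 2 fun p : ℝ × ℝ => E t p.1 p.2 := by
  rw [← contDiffOn_univ]
  exact hE.comp (f := fun p : ℝ × ℝ => (t, p.1, p.2)) (by fun_prop) fun p _ => ⟨ht, mem_univ _⟩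

theorem continuous_slice {F : ℝ × ℝ × ℝ → ℝ} (hF : ContinuousOn F (Ioi (0 : ℝ) ×ˢ univ))
    {t : ℝ} (ht : 0 < t) : Continuous fun p : ℝ × ℝ => F (t, p) := by
  rw [← continuousOn_univ]
  exact hF.comp (f := fun p : ℝ × ℝ => (t, p)) (by fun_prop) fun p _ => ⟨ht, mem_univ _⟩

namespace IsKineticSolution

variable {s a b κ : ℝ} {m : ℝ → ℝ} {u : ℝ → ℝ → ℝ → ℝ}

theorem contDiffOn_quotient (hu : IsKineticSolution s a b κ m u) (hm2 : ContDiff ℝ 2 m)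
    (hm : ∀ v, 0 < m v) : ContDiffOn ℝ 2
      (fun p : ℝ × ℝ × ℝ => u p.1 p.2.1 p.2.2 ^ 2 / m p.2.2) (Ioi (0 : ℝ) ×ˢ univ) := by
  refine (hu.contDiffOn.pow 2).div (ContDiff.contDiffOn ?_) fun p _ => (hm _).ne'
  exact hm2.comp (by fun_prop)

theorem continuous_energyDensity (hu : IsKineticSolution s a b κ m u) (hm2 : ContDiff ℝ 2 m)
    (hm : ∀ v, 0 < m v) {t : ℝ} (ht : 0 < t) :
    Continuous fun p : ℝ × ℝ => u t p.1 p.2 ^ 2 / m p.2 :=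
  continuous_slice (hu.contDiffOn_quotient hm2 hm).continuousOn ht

theorem kineticEnergySq_eq (hu : IsKineticSolution s a b κ m u) (hm2 : ContDiff ℝ 2 m)
    (hm : ∀ v, 0 < m v) {t : ℝ} (ht : 0 < t) : kineticEnergySq m (u t) =
      ∫⁻ p : ℝ × ℝ, ENNReal.ofReal (u t p.1 p.2 ^ 2 / m p.2) :=
  (lintegral_prod _
    (hu.continuous_energyDensity hm2 hm ht).measurable.ennreal_ofReal.aemeasurable).symm

theorem integrable_energyDensity (hu : IsKineticSolution s a b κ m u) (hm2 : ContDiff ℝ 2 m)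
    (hm : ∀ v, 0 < m v) (T : ℝ) :
    Integrable (fun p : ℝ × ℝ × ℝ => u p.1 p.2.1 p.2.2 ^ 2 / m p.2.2)
      ((volume.restrict (Ioo 0 T)).prod volume) := by
  have hsub : Ioo 0 T ×ˢ (univ : Set (ℝ × ℝ)) ⊆ Ioi (0 : ℝ) ×ˢ univ :=
    prod_mono (fun t ht => ht.1) le_rfl
  have hmeas : AEStronglyMeasurable (fun p : ℝ × ℝ × ℝ => u p.1 p.2.1 p.2.2 ^ 2 / m p.2.2)
      ((volume.restrict (Ioo 0 T)).prod volume) := by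
    have h1 := ((hu.contDiffOn_quotient hm2 hm).continuousOn.mono hsub).aestronglyMeasurable
      (μ := (volume : Measure ℝ).prod (volume : Measure (ℝ × ℝ)))
      (measurableSet_Ioo.prod MeasurableSet.univ)
    rwa [← Measure.prod_restrict, Measure.restrict_univ] at h1
  refine ⟨hmeas, ?_⟩
  rw [hasFiniteIntegral_iff_ofReal (ae_of_all _ fun p => div_nonneg (sq_nonneg _) (hm _).le),
    lintegral_prod _ hmeas.aemeasurable.ennreal_ofReal]
  refine lt_of_eq_of_lt ?_ (hu.energy T)
  refine setLIntegral_congr_fun measurableSet_Ioo fun t ht => ?_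
  exact (hu.kineticEnergySq_eq hm2 hm ht.1).symm

/-- The dissipation inequality at a fixed time, tested with the phase space cutoff. -/
theorem integral_phaseCutoff_mul_deriv_le (hs : s ∈ Ioo (0 : ℝ) 1) (hκ : 0 ≤ κ)
    (hu : IsKineticSolution s a b κ m u) (hm2 : ContDiff ℝ 2 m) (hm : ∀ v, 0 < m v)
    (hmL : ∀ v, HasFracLaplacian s m v (κ * deriv (fun w => w * m w) v))
    {Et : ℝ × ℝ × ℝ → ℝ} (hEtc : ContinuousOn Et (Ioi (0 : ℝ) ×ˢ univ))
    (hEt : ∀ t > 0, ∀ x v, HasDerivAt (fun τ => u τ x v ^ 2 / m v) (Et (t, x, v)) t)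
    {C Λ R : ℝ} (hR : 1 ≤ R)
    (hC : ∀ R > 0, ∀ v, |deriv (cutoff R) v| ≤ C / R ∧
      |v * deriv (cutoff R) v| ≤ {v : ℝ | R ≤ |v|}.indicator (fun _ => C) v)
    (hΛ : ∀ δ > 0, ∀ v, |truncLap s δ (cutoff R) v| ≤ Λ) {t : ℝ} (ht : 0 < t)
    (hi : Integrable fun p : ℝ × ℝ => u t p.1 p.2 ^ 2 / m p.2) :
    a * ∫ p : ℝ × ℝ, phaseCutoff R p * Et (t, p) ≤
      ∫ p : ℝ × ℝ, (κ * {v : ℝ | R ≤ |v|}.indicator (fun _ => C) p.2 + fracLapConst s * Λ +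
        |b| * (2 * C / R)) * (u t p.1 p.2 ^ 2 / m p.2) := by
  have hR0 : 0 < R := by linarith
  obtain ⟨_, Ex, -, hExc, hEx'⟩ := exists_partial_derivs (E := fun t x v => u t x v ^ 2 / m v)
    (hu.contDiffOn_quotient hm2 hm)
  have hEx : ∀ x v, HasDerivAt (fun y => u t y v ^ 2 / m v) (Ex (t, x, v)) x :=
    fun x v => (hEx' t ht x v).2
  have hC0 : 0 ≤ C := by
    have := (abs_nonneg _).trans (hC 1 one_pos 0).1
    simpa using this
  have hΛ0 : 0 ≤ Λ := (abs_nonneg _).trans (hΛ 1 one_pos 0)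
  have hc0 := fracLapConst_nonneg hs
  set e : ℝ × ℝ → ℝ := fun p => u t p.1 p.2 ^ 2 / m p.2 with he
  have he0 : ∀ p, 0 ≤ e p := fun p => div_nonneg (sq_nonneg _) (hm _).le
  have hec : Continuous e := hu.continuous_energyDensity hm2 hm ht
  have hEts : Continuous fun p : ℝ × ℝ => Et (t, p) := continuous_slice hEtc ht
  have hExs : Continuous fun p : ℝ × ℝ => Ex (t, p) := continuous_slice hExc ht
  set α := cutoff (R ^ 2) with hα
  set β := cutoff R with hβ
  have hαc : Continuous α := (cutoff_contDiff _).continuous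
  have hβc : Continuous β := (cutoff_contDiff _).continuous
  have hdα : Continuous (deriv α) := (cutoff_contDiff _).continuous_deriv (by norm_num)
  have hdβ : Continuous (deriv β) := (cutoff_contDiff _).continuous_deriv (by norm_num)
  have hα0 : ∀ x ∉ Icc (-(2 * R ^ 2)) (2 * R ^ 2), α x = 0 :=
    fun x hx => cutoff_sq_eq_zero_of_notMem_Icc hR hx
  have hβ0 : ∀ x ∉ Icc (-(2 * R ^ 2)) (2 * R ^ 2), β x = 0 :=
    fun x hx => cutoff_eq_zero_of_notMem_Icc hR hx
  have hdα0 : ∀ x ∉ Icc (-(2 * R ^ 2)) (2 * R ^ 2), deriv α x = 0 := by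
    intro x hx
    by_contra hcon
    exact hx (tsupport_cutoff_subset (by positivity) (support_deriv_subset hcon))
  -- the production of `u²/m`, for almost every position
  let P : ℝ × ℝ → ℝ := fun p => a * Et (t, p) + b * p.2 * Ex (t, p)
  have hPc : Continuous P :=
    (continuous_const.mul hEts).add ((continuous_const.mul continuous_snd).mul hExs)
  have hPv : ∀ x v, ∃ l, HasFracLaplacian s (u t x) v l ∧
      P (x, v) = 2 * (u t x v / m v) * (κ * deriv (fun w => w * u t x w) v - l) := by
    intro x v
    obtain ⟨l, hl, heq⟩ := hu.equation t ht x v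
    refine ⟨l, hl, ?_⟩
    rw [← heq]
    obtain ⟨ut, ux, _, _, hux⟩ := exists_partial_derivs hu.contDiffOn
    obtain ⟨h1, h2⟩ := hux t ht x v
    have e1 : Et (t, x, v) = 2 * u t x v * ut (t, x, v) / m v := by
      have := (h1.pow 2).div_const (m v)
      exact (hEt t ht x v).unique (by simpa using! this)
    have e2 : Ex (t, x, v) = 2 * u t x v * ux (t, x, v) / m v := by
      have := (h2.pow 2).div_const (m v)
      exact (hEx x v).unique (by simpa using! this)
    simp only [P]
    rw [h1.deriv, h2.deriv, e1, e2]
    ring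
  have hfiber : ∀ᵐ x : ℝ, α x * ∫ v, β v * P (x, v) ≤
      α x * ∫ v, (κ * |v * deriv β v| + fracLapConst s * Λ) * e (x, v) := by
    filter_upwards [hi.prod_right_ae] with x hx
    refine mul_le_mul_of_nonneg_left ?_ (cutoff_nonneg _ _)
    have hsl : ContDiff ℝ 2 (u t x) :=
      (contDiff_slice hu.contDiffOn ht).comp (f := fun v : ℝ => (x, v)) (by fun_prop)
    exact integral_mul_production_le hs hκ hm2 hm hmL hsl (hPv x) (by fun_prop) hx
      (cutoff_contDiff R) (hasCompactSupport_cutoff hR0) (cutoff_nonneg R) hΛ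
  have iP : Integrable fun p : ℝ × ℝ => α p.1 * (β p.2 * P p) := by
    refine integrable_of_phaseBox (R := R) (by fun_prop) fun p hp => ?_
    rw [← mul_assoc, mul_eq_zero_of_notMem_phaseBox hα0 hβ0 hp, zero_mul]
  have hindle : ∀ v, {v : ℝ | R ≤ |v|}.indicator (fun _ => C) v ≤ C :=
    fun v => indicator_apply_le' (fun _ => le_rfl) (fun _ => hC0)
  have iS : Integrable fun p : ℝ × ℝ =>
      α p.1 * ((κ * |p.2 * deriv β p.2| + fracLapConst s * Λ) * e p) := by
    have : Integrable fun p : ℝ × ℝ =>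
        (α p.1 * (κ * |p.2 * deriv β p.2| + fracLapConst s * Λ)) * e p := by
      refine hi.bdd_mul (c := κ * C + fracLapConst s * Λ)
        (Continuous.aestronglyMeasurable (by fun_prop)) (ae_of_all _ fun p => ?_)
      rw [Real.norm_eq_abs, abs_mul, abs_of_nonneg (cutoff_nonneg _ p.1), abs_of_nonneg
        (by positivity : 0 ≤ κ * |p.2 * deriv β p.2| + fracLapConst s * Λ)]
      refine (mul_le_of_le_one_left (by positivity) (cutoff_le_one _ _)).trans ?_
      have := ((hC R hR0 p.2).2.trans (hindle p.2))
      gcongr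
    exact this.congr (ae_of_all _ fun p => by ring)
  have h1 : ∫ p : ℝ × ℝ, α p.1 * (β p.2 * P p) ≤
      ∫ p : ℝ × ℝ, α p.1 * ((κ * |p.2 * deriv β p.2| + fracLapConst s * Λ) * e p) := by
    have e1 := integral_prod _ iP
    have e2 := integral_prod _ iS
    rw [← Measure.volume_eq_prod] at e1 e2
    rw [e1, e2]
    refine integral_mono_ae iP.integral_prod_left iS.integral_prod_left ?_
    filter_upwards [hfiber] with x hx
    simp only [integral_const_mul]
    exact hx
  -- integration by parts in the transport term
  have iX : Integrable fun p : ℝ × ℝ => α p.1 * (β p.2 * (p.2 * Ex (t, p))) := by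
    refine integrable_of_phaseBox (R := R) ((hαc.comp continuous_fst).mul
      ((hβc.comp continuous_snd).mul (continuous_snd.mul hExs))) fun p hp => ?_
    rw [← mul_assoc, mul_eq_zero_of_notMem_phaseBox hα0 hβ0 hp, zero_mul]
  have iY : Integrable fun p : ℝ × ℝ => deriv α p.1 * (β p.2 * (p.2 * e p)) := by
    refine integrable_of_phaseBox (R := R) (by fun_prop) fun p hp => ?_
    rw [← mul_assoc, mul_eq_zero_of_notMem_phaseBox hdα0 hβ0 hp, zero_mul]
  have h2 : ∫ p : ℝ × ℝ, α p.1 * (β p.2 * (p.2 * Ex (t, p))) =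
      -∫ p : ℝ × ℝ, deriv α p.1 * (β p.2 * (p.2 * e p)) := by
    have e1 := integral_prod_symm _ iX
    have e2 := integral_prod_symm _ iY
    rw [← Measure.volume_eq_prod] at e1 e2
    rw [e1, e2, ← integral_neg]
    congr 1
    ext v
    have hcα : HasCompactSupport α := hasCompactSupport_cutoff (by positivity)
    refine integral_mul_deriv_eq_deriv_mul_of_integrable (u := α) (u' := deriv α)
      (v := fun x => β v * (v * e (x, v))) (v' := fun x => β v * (v * Ex (t, x, v)))
      (fun x _ => ((cutoff_contDiff _).differentiable (by norm_num) x).hasDerivAt)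
      (fun x _ => ((hEx x v).const_mul v).const_mul (β v)) ?_ ?_ ?_
    · refine Continuous.integrable_of_hasCompactSupport (hαc.mul ?_) hcα.mul_right
      have : Continuous fun x : ℝ => Ex (t, x, v) :=
        hExs.comp (by fun_prop : Continuous fun x => (x, v))
      exact continuous_const.mul (continuous_const.mul this)
    · exact Continuous.integrable_of_hasCompactSupport (by fun_prop) hcα.deriv.mul_right
    · exact Continuous.integrable_of_hasCompactSupport (by fun_prop) hcα.mul_right
  have iT : Integrable fun p : ℝ × ℝ => phaseCutoff R p * Et (t, p) := by
    refine integrable_of_phaseBox (R := R) ((continuous_phaseCutoff R).mul hEts)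
      fun p hp => ?_
    rw [phaseCutoff_eq_zero hR hp, zero_mul]
  have h3 : ∫ p : ℝ × ℝ, α p.1 * (β p.2 * P p) = a * (∫ p : ℝ × ℝ, phaseCutoff R p * Et (t, p)) +
      b * ∫ p : ℝ × ℝ, α p.1 * (β p.2 * (p.2 * Ex (t, p))) := by
    rw [← integral_const_mul, ← integral_const_mul,
      ← integral_add (iT.const_mul a) (iX.const_mul b)]
    congr 1; ext p; simp only [P, phaseCutoff]; ring
  have h4 : a * ∫ p : ℝ × ℝ, phaseCutoff R p * Et (t, p) ≤
      (∫ p : ℝ × ℝ, α p.1 * ((κ * |p.2 * deriv β p.2| + fracLapConst s * Λ) * e p)) +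
      ∫ p : ℝ × ℝ, b * (deriv α p.1 * (β p.2 * (p.2 * e p))) := by
    rw [integral_const_mul]
    rw [h3, h2] at h1
    linarith
  refine h4.trans ?_
  rw [← integral_add iS (iY.const_mul b)]
  have iErr : Integrable fun p : ℝ × ℝ => (κ * {v : ℝ | R ≤ |v|}.indicator (fun _ => C) p.2 +
      fracLapConst s * Λ + |b| * (2 * C / R)) * e p := by
    refine hi.bdd_mul (c := κ * C + fracLapConst s * Λ + |b| * (2 * C / R)) ?_
      (ae_of_all _ fun p => ?_)
    · have : Measurable ({v : ℝ | R ≤ |v|}.indicator (fun _ => C)) :=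
        measurable_const.indicator (measurableSet_le_abs R)
      exact Measurable.aestronglyMeasurable (by fun_prop)
    · have h5 : 0 ≤ {v : ℝ | R ≤ |v|}.indicator (fun _ => C) p.2 :=
        indicator_nonneg (fun _ _ => hC0) _
      rw [Real.norm_of_nonneg (by positivity)]
      have := hindle p.2
      gcongr
  refine integral_mono (iS.add (iY.const_mul b)) iErr fun p => ?_
  have g1 : α p.1 * ((κ * |p.2 * deriv β p.2| + fracLapConst s * Λ) * e p) ≤
      (κ * {v : ℝ | R ≤ |v|}.indicator (fun _ => C) p.2 + fracLapConst s * Λ) * e p := by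
    refine (mul_le_of_le_one_left (mul_nonneg (by positivity) (he0 p)) (cutoff_le_one _ _)).trans ?_
    have := (hC R hR0 p.2).2
    exact mul_le_mul_of_nonneg_right (by gcongr) (he0 p)
  have g2 : b * (deriv α p.1 * (β p.2 * (p.2 * e p))) ≤ |b| * (2 * C / R) * e p := by
    have k1 : |deriv α p.1| ≤ C / R ^ 2 := (hC (R ^ 2) (by positivity) p.1).1
    have k2 : |β p.2 * p.2| ≤ 2 * R := by
      by_cases hp : |p.2| ≤ 2 * R
      · rw [abs_mul]
        exact (mul_le_of_le_one_left (abs_nonneg _) (abs_cutoff_le_one _ _)).trans hp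
      · rw [show β p.2 = 0 from cutoff_eq_zero hR0 (not_le.1 hp).le, zero_mul, abs_zero]
        positivity
    have k3 : |b * (deriv α p.1 * (β p.2 * p.2))| ≤ |b| * (2 * C / R) := by
      rw [abs_mul, abs_mul]
      have : C / R ^ 2 * (2 * R) = 2 * C / R := by field_simp
      rw [← this]
      gcongr
    have k4 := mul_le_mul_of_nonneg_right ((le_abs_self _).trans k3) (he0 p)
    linarith
  simp only
  linarith

/-- The fundamental theorem of calculus in time for the truncated energy. -/
theorem integral_phaseCutoff_sub (hu : IsKineticSolution s a b κ m u) (hm2 : ContDiff ℝ 2 m)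
    (hm : ∀ v, 0 < m v) {Et : ℝ × ℝ × ℝ → ℝ} (hEtc : ContinuousOn Et (Ioi (0 : ℝ) ×ˢ univ))
    (hEt : ∀ t > 0, ∀ x v, HasDerivAt (fun τ => u τ x v ^ 2 / m v) (Et (t, x, v)) t)
    {R τ t : ℝ} (hR : 1 ≤ R) (hτ : 0 < τ) (hτt : τ < t) :
    Integrable (fun r => ∫ p : ℝ × ℝ, phaseCutoff R p * Et (r, p)) (volume.restrict (Ioc τ t)) ∧
    (∫ p : ℝ × ℝ, phaseCutoff R p * (u t p.1 p.2 ^ 2 / m p.2)) -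
      ∫ p : ℝ × ℝ, phaseCutoff R p * (u τ p.1 p.2 ^ 2 / m p.2) =
    ∫ r in Ioc τ t, ∫ p : ℝ × ℝ, phaseCutoff R p * Et (r, p) := by
  have hχ := continuous_phaseCutoff R
  have hsub : ∀ A : Set (ℝ × ℝ), Icc τ t ×ˢ A ⊆ Ioi (0 : ℝ) ×ˢ univ :=
    fun A => prod_mono (fun r hr => hτ.trans_le hr.1) (subset_univ A)
  have hcont : ContinuousOn (fun q : ℝ × ℝ × ℝ => phaseCutoff R q.2 * Et q)
      (Icc τ t ×ˢ univ) :=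
    (hχ.comp continuous_snd).continuousOn.mul (hEtc.mono (hsub univ))
  have hint : Integrable (fun q : ℝ × ℝ × ℝ => phaseCutoff R q.2 * Et q)
      ((volume.restrict (Ioc τ t)).prod volume) := by
    have h1 : IntegrableOn (fun q : ℝ × ℝ × ℝ => phaseCutoff R q.2 * Et q)
        (Icc τ t ×ˢ phaseBox R) :=
      (hcont.mono (prod_mono le_rfl (subset_univ _))).integrableOn_compact
        (isCompact_Icc.prod (isCompact_phaseBox R))
    have h2 : IntegrableOn (fun q : ℝ × ℝ × ℝ => phaseCutoff R q.2 * Et q)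
        (Icc τ t ×ˢ univ) := by
      refine h1.of_forall_sdiff_eq_zero (measurableSet_Icc.prod MeasurableSet.univ) fun q hq => ?_
      rw [phaseCutoff_eq_zero hR (fun h => hq.2 ⟨hq.1.1, h⟩), zero_mul]
    have h3 := h2.mono_set (prod_mono Ioc_subset_Icc_self (le_refl (univ : Set (ℝ × ℝ))))
    rwa [IntegrableOn, Measure.volume_eq_prod, ← Measure.prod_restrict, Measure.restrict_univ]
      at h3
  refine ⟨hint.integral_prod_left, ?_⟩
  have hei : ∀ r, 0 < r → Integrable fun p : ℝ × ℝ =>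
      phaseCutoff R p * (u r p.1 p.2 ^ 2 / m p.2) := fun r hr =>
    integrable_of_phaseBox (R := R)
      (hχ.mul (hu.continuous_energyDensity hm2 hm hr)) fun p hp => by
      rw [phaseCutoff_eq_zero hR hp, zero_mul]
  rw [← integral_sub (hei t (hτ.trans hτt)) (hei τ hτ),
    integral_integral_swap (f := fun r p => phaseCutoff R p * Et (r, p)) hint]
  congr 1
  ext p
  rw [integral_const_mul, ← mul_sub]
  congr 1
  have hp : ContinuousOn (fun r => Et (r, p)) (uIcc τ t) := by
    rw [uIcc_of_le hτt.le]
    exact hEtc.comp (f := fun r : ℝ => (r, p)) (by fun_prop)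
      fun r hr => mk_mem_prod (hτ.trans_le hr.1) (mem_univ _)
  rw [← intervalIntegral.integral_of_le hτt.le]
  refine (intervalIntegral.integral_eq_sub_of_hasDerivAt
    (f := fun r => u r p.1 p.2 ^ 2 / m p.2) (fun r hr => ?_) hp.intervalIntegrable).symm
  rw [uIcc_of_le hτt.le] at hr
  exact hEt r (hτ.trans_le hr.1) p.1 p.2

/-- Up to an error that vanishes as the cutoff is removed, and is uniform in the two times, the
truncated energy does not increase. Only the integrability of the energy in time enters. -/
theorem exists_energy_error (hs : s ∈ Ioo (0 : ℝ) 1) (ha : 0 < a) (hκ : 0 ≤ κ)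
    (hu : IsKineticSolution s a b κ m u) (hm2 : ContDiff ℝ 2 m) (hm : ∀ v, 0 < m v)
    (hmL : ∀ v, HasFracLaplacian s m v (κ * deriv (fun w => w * m w) v)) (T : ℝ) :
    ∃ err : ℝ → ℝ, Tendsto err atTop (𝓝 0) ∧ ∀ R ≥ 1, ∀ τ t, 0 < τ → τ < t → t < T →
      ∫⁻ p : ℝ × ℝ, ENNReal.ofReal (phaseCutoff R p * (u t p.1 p.2 ^ 2 / m p.2)) ≤
      (∫⁻ p : ℝ × ℝ, ENNReal.ofReal (phaseCutoff R p * (u τ p.1 p.2 ^ 2 / m p.2))) +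
        ENNReal.ofReal (err R) := by
  obtain ⟨C, hC0, hC⟩ := exists_bound_deriv_cutoff
  obtain ⟨Λ, hΛlim, hΛ⟩ := exists_bound_truncLap_cutoff hs
  obtain ⟨Et, _, hEtc, -, hE⟩ := exists_partial_derivs (E := fun t x v => u t x v ^ 2 / m v)
    (hu.contDiffOn_quotient hm2 hm)
  have hEt : ∀ t > 0, ∀ x v, HasDerivAt (fun τ => u τ x v ^ 2 / m v) (Et (t, x, v)) t :=
    fun t ht x v => (hE t ht x v).1
  have hint := hu.integrable_energyDensity hm2 hm T
  have hc0 := fracLapConst_nonneg hs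
  let W : ℝ → ℝ → ℝ := fun R v => κ * {v : ℝ | R ≤ |v|}.indicator (fun _ => C) v +
    fracLapConst s * Λ R + |b| * (2 * C / R)
  let e : ℝ × ℝ × ℝ → ℝ := fun q => u q.1 q.2.1 q.2.2 ^ 2 / m q.2.2
  have he0 : ∀ q, 0 ≤ e q := fun q => div_nonneg (sq_nonneg _) (hm _).le
  have hind0 : ∀ R v, 0 ≤ {v : ℝ | R ≤ |v|}.indicator (fun _ => C) v :=
    fun R v => indicator_nonneg (fun _ _ => hC0) v
  have hindle : ∀ R v, {v : ℝ | R ≤ |v|}.indicator (fun _ => C) v ≤ C :=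
    fun R v => indicator_apply_le' (fun _ => le_rfl) (fun _ => hC0)
  have hWm : ∀ R, Measurable (W R) := by
    intro R
    have : Measurable ({v : ℝ | R ≤ |v|}.indicator (fun _ => C)) :=
      measurable_const.indicator (measurableSet_le_abs R)
    fun_prop
  have hΛ0 : ∀ R > 0, 0 ≤ Λ R := fun R hR => (abs_nonneg _).trans (hΛ R hR 1 one_pos 0)
  have hW0 : ∀ R > 0, ∀ v, 0 ≤ W R v := by
    intro R hR v
    have := hΛ0 R hR
    have := hind0 R v
    positivity
  have hWle : ∀ R > 0, ∀ v, |W R v| ≤ κ * C + fracLapConst s * Λ R + |b| * (2 * C / R) := by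
    intro R hR v
    rw [abs_of_nonneg (hW0 R hR v)]
    have := hindle R v
    simp only [W]
    gcongr
  have hWi : ∀ R > 0, Integrable (fun q : ℝ × ℝ × ℝ => W R q.2.2 * e q)
      ((volume.restrict (Ioo 0 T)).prod volume) := fun R hR =>
    hint.bdd_mul ((hWm R).comp (measurable_snd.comp measurable_snd)).aestronglyMeasurable
      (ae_of_all _ fun q => hWle R hR q.2.2)
  let err : ℝ → ℝ := fun R => ∫ q, W R q.2.2 * e q ∂((volume.restrict (Ioo 0 T)).prod volume)
  have herr : Tendsto err atTop (𝓝 0) := by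
    have h := tendsto_integral_filter_of_dominated_convergence (l := atTop)
      (μ := (volume.restrict (Ioo 0 T)).prod (volume : Measure (ℝ × ℝ)))
      (F := fun R q => W R q.2.2 * e q) (f := fun _ => 0)
      (fun q => (κ * C + fracLapConst s + |b| * (2 * C)) * e q) ?_ ?_ (hint.const_mul _) ?_
    · simpa using h
    · filter_upwards [eventually_gt_atTop 0] with R hR
      exact (hWi R hR).aestronglyMeasurable
    · filter_upwards [eventually_ge_atTop 1, hΛlim.eventually_le_const one_pos] with R hR hΛ1
      refine ae_of_all _ fun q => ?_
      rw [Real.norm_eq_abs, abs_mul, abs_of_nonneg (he0 q)]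
      refine mul_le_mul_of_nonneg_right ((hWle R (by linarith) _).trans ?_) (he0 q)
      have h1 : 2 * C / R ≤ 2 * C := div_le_self (by positivity) hR
      have h2 : fracLapConst s * Λ R ≤ fracLapConst s := mul_le_of_le_one_right hc0 hΛ1
      gcongr
    · refine ae_of_all _ fun q => ?_
      have h1 : Tendsto (fun R => κ * {v : ℝ | R ≤ |v|}.indicator (fun _ => C) q.2.2) atTop
          (𝓝 0) := by
        refine tendsto_const_nhds.congr' ?_
        filter_upwards [eventually_gt_atTop |q.2.2|] with R hR
        rw [indicator_of_notMem (by exact not_le.2 hR), mul_zero]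
      have h2 : Tendsto (fun R => fracLapConst s * Λ R) atTop (𝓝 0) := by
        simpa using hΛlim.const_mul (fracLapConst s)
      have h3 : Tendsto (fun R : ℝ => |b| * (2 * C / R)) atTop (𝓝 0) := by
        simpa using (tendsto_const_nhds (x := 2 * C)).div_atTop tendsto_id |>.const_mul |b|
      simpa using ((h1.add h2).add h3).mul_const (e q)
  refine ⟨fun R => err R / a, by simpa using herr.div_const a, fun R hR τ t hτ hτt htT => ?_⟩
  have hR0 : 0 < R := by linarith
  obtain ⟨hJi, hJ⟩ := hu.integral_phaseCutoff_sub hm2 hm hEtc hEt hR hτ hτt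
  have hae : ∀ᵐ r ∂(volume.restrict (Ioo 0 T)), Integrable fun p : ℝ × ℝ => e (r, p) :=
    hint.prod_right_ae
  have hsub : Ioc τ t ⊆ Ioo 0 T := fun r hr => ⟨hτ.trans hr.1, hr.2.trans_lt htT⟩
  have hSi := (hWi R hR0).integral_prod_left
  have hmain : a * ∫ r in Ioc τ t, ∫ p : ℝ × ℝ, phaseCutoff R p * Et (r, p) ≤ err R := by
    rw [← integral_const_mul]
    calc ∫ r in Ioc τ t, a * ∫ p : ℝ × ℝ, phaseCutoff R p * Et (r, p)
        ≤ ∫ r in Ioc τ t, ∫ p : ℝ × ℝ, W R p.2 * e (r, p) := by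
          refine integral_mono_ae (hJi.const_mul a) (IntegrableOn.mono_set hSi hsub) ?_
          filter_upwards [ae_restrict_of_ae_restrict_of_subset hsub hae,
            ae_restrict_mem measurableSet_Ioc] with r hr hrm
          exact integral_phaseCutoff_mul_deriv_le hs hκ hu hm2 hm hmL hEtc hEt hR hC
            (hΛ R hR0) (hτ.trans hrm.1) hr
      _ ≤ ∫ r in Ioo 0 T, ∫ p : ℝ × ℝ, W R p.2 * e (r, p) := by
          refine setIntegral_mono_set hSi (ae_of_all _ fun r => ?_) hsub.eventuallyLE
          exact integral_nonneg fun p => mul_nonneg (hW0 R hR0 _) (he0 _)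
      _ = err R := (integral_prod _ (hWi R hR0)).symm
  rw [← hJ, ← le_div_iff₀' ha] at hmain
  have hei : ∀ r, 0 < r → Integrable fun p : ℝ × ℝ =>
      phaseCutoff R p * (u r p.1 p.2 ^ 2 / m p.2) := fun r hr =>
    integrable_of_phaseBox (R := R)
      ((continuous_phaseCutoff R).mul (hu.continuous_energyDensity hm2 hm hr)) fun p hp => by
      rw [phaseCutoff_eq_zero hR hp, zero_mul]
  have hnn : ∀ r, 0 ≤ᵐ[volume] fun p : ℝ × ℝ => phaseCutoff R p * (u r p.1 p.2 ^ 2 / m p.2) :=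
    fun r => ae_of_all _ fun p => mul_nonneg (phaseCutoff_nonneg _ _)
      (div_nonneg (sq_nonneg _) (hm _).le)
  rw [← ofReal_integral_eq_lintegral_ofReal (hei t (hτ.trans hτt)) (hnn t),
    ← ofReal_integral_eq_lintegral_ofReal (hei τ hτ) (hnn τ)]
  exact (ENNReal.ofReal_le_ofReal (by linarith)).trans ENNReal.ofReal_add_le

/-- Removal of the cutoff, by Fatou's lemma. -/
theorem kineticEnergySq_le_of_phaseCutoff (hu : IsKineticSolution s a b κ m u)
    (hm2 : ContDiff ℝ 2 m) (hm : ∀ v, 0 < m v) {t : ℝ} (ht : 0 < t) {err : ℝ → ℝ}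
    (herr : Tendsto err atTop (𝓝 0)) {Y : ℝ≥0∞}
    (h : ∀ R ≥ 1, ∫⁻ p : ℝ × ℝ, ENNReal.ofReal (phaseCutoff R p * (u t p.1 p.2 ^ 2 / m p.2)) ≤
      Y + ENNReal.ofReal (err R)) : kineticEnergySq m (u t) ≤ Y := by
  rw [hu.kineticEnergySq_eq hm2 hm ht]
  have hcast := tendsto_natCast_atTop_atTop (R := ℝ)
  have hlim : Tendsto (fun n : ℕ => Y + ENNReal.ofReal (err n)) atTop (𝓝 Y) := by
    have h1 := ENNReal.tendsto_ofReal (herr.comp hcast)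
    rw [ENNReal.ofReal_zero] at h1
    simpa using h1.const_add Y
  have hcont := hu.continuous_energyDensity hm2 hm ht
  calc ∫⁻ p : ℝ × ℝ, ENNReal.ofReal (u t p.1 p.2 ^ 2 / m p.2)
      = ∫⁻ p : ℝ × ℝ, liminf (fun n : ℕ =>
          ENNReal.ofReal (phaseCutoff n p * (u t p.1 p.2 ^ 2 / m p.2))) atTop := by
        congr 1; ext p
        refine (Tendsto.liminf_eq (tendsto_const_nhds.congr' ?_)).symm
        filter_upwards [hcast.eventually (phaseCutoff_eventually_eq_one p)] with n hn
        rw [hn, one_mul]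
    _ ≤ liminf (fun n : ℕ => ∫⁻ p : ℝ × ℝ,
          ENNReal.ofReal (phaseCutoff n p * (u t p.1 p.2 ^ 2 / m p.2))) atTop :=
        lintegral_liminf_le fun n =>
          ((continuous_phaseCutoff n).mul hcont).measurable.ennreal_ofReal
    _ ≤ liminf (fun n : ℕ => Y + ENNReal.ofReal (err n)) atTop := by
        refine liminf_le_liminf ?_
        filter_upwards [eventually_ge_atTop 1] with n hn
        exact h n (by exact_mod_cast hn)
    _ = Y := hlim.liminf_eq

theorem aemeasurable_kineticEnergySq (hu : IsKineticSolution s a b κ m u) (hm2 : ContDiff ℝ 2 m)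
    (hm : ∀ v, 0 < m v) (T : ℝ) :
    AEMeasurable (fun t => kineticEnergySq m (u t)) (volume.restrict (Ioo 0 T)) := by
  refine (hu.integrable_energyDensity hm2 hm
    T).aestronglyMeasurable.aemeasurable.ennreal_ofReal.lintegral_prod_right'.congr ?_
  filter_upwards [ae_restrict_mem measurableSet_Ioo] with t ht
  exact (hu.kineticEnergySq_eq hm2 hm ht.1).symm

/-- The energy of a finite-energy solution is non-increasing. -/
theorem kineticEnergySq_antitone (hs : s ∈ Ioo (0 : ℝ) 1) (ha : 0 < a) (hκ : 0 ≤ κ)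
    (hu : IsKineticSolution s a b κ m u) (hm2 : ContDiff ℝ 2 m) (hm : ∀ v, 0 < m v)
    (hmL : ∀ v, HasFracLaplacian s m v (κ * deriv (fun w => w * m w) v)) :
    AntitoneOn (fun t => kineticEnergySq m (u t)) (Ioi 0) := by
  intro τ hτ t ht hτt
  rcases hτt.eq_or_lt with rfl | hlt
  · exact le_rfl
  obtain ⟨err, herr, h⟩ := hu.exists_energy_error hs ha hκ hm2 hm hmL (t + 1)
  refine hu.kineticEnergySq_le_of_phaseCutoff hm2 hm ht herr fun R hR =>
    (h R hR τ t hτ hlt (by linarith)).trans (add_le_add_left ?_ _)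
  change _ ≤ kineticEnergySq m (u τ)
  rw [hu.kineticEnergySq_eq hm2 hm hτ]
  refine lintegral_mono fun p => ENNReal.ofReal_le_ofReal ?_
  exact mul_le_of_le_one_left (div_nonneg (sq_nonneg _) (hm _).le) (phaseCutoff_le_one R p)

/-- The energy of a finite-energy solution is at most that of its initial datum. -/
theorem kineticEnergySq_le_initial (hs : s ∈ Ioo (0 : ℝ) 1) (ha : 0 < a) (hκ : 0 ≤ κ)
    (hu : IsKineticSolution s a b κ m u) (hm2 : ContDiff ℝ 2 m) (hm : ∀ v, 0 < m v)
    (hmL : ∀ v, HasFracLaplacian s m v (κ * deriv (fun w => w * m w) v))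
    {u₀ : ℝ → ℝ → ℝ} (hu₀ : Measurable (Function.uncurry u₀)) (hinit : AttainsInitialData u u₀)
    {t : ℝ} (ht : 0 < t) : kineticEnergySq m (u t) ≤ kineticEnergySq m u₀ := by
  have hu₀' : Measurable fun p : ℝ × ℝ => u₀ p.1 p.2 := hu₀
  have hmm : Measurable m := hm2.continuous.measurable
  have hE₀ : kineticEnergySq m u₀ = ∫⁻ p : ℝ × ℝ, ENNReal.ofReal (u₀ p.1 p.2 ^ 2 / m p.2) :=
    (lintegral_prod (fun p : ℝ × ℝ => ENNReal.ofReal (u₀ p.1 p.2 ^ 2 / m p.2))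
      (by fun_prop)).symm
  obtain ⟨err, herr, h⟩ := hu.exists_energy_error hs ha hκ hm2 hm hmL (t + 1)
  -- This rests on `y² ≤ (1 + θ) z² + (1 + 1/θ) (y - z)²` with `y = u(τ)` and `z = u₀`: as `τ → 0`
  -- at fixed `R`, the last term vanishes on the compact support of the cutoff.
  have key : ∀ θ > 0, kineticEnergySq m (u t) ≤
      ENNReal.ofReal (1 + θ) * kineticEnergySq m u₀ := by
    intro θ hθ
    refine hu.kineticEnergySq_le_of_phaseCutoff hm2 hm ht herr fun R hR => ?_
    obtain ⟨B, hB⟩ := (isCompact_Icc (a := -(2 * R ^ 2))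
      (b := 2 * R ^ 2)).exists_bound_of_continuousOn
      (hm2.continuous.inv₀ fun v => (hm v).ne').continuousOn
    let D : ℝ → ℝ≥0∞ := fun τ => ∫⁻ x in Icc (-(2 * R ^ 2)) (2 * R ^ 2),
      ∫⁻ v in Icc (-(2 * R ^ 2)) (2 * R ^ 2), ENNReal.ofReal ((u τ x v - u₀ x v) ^ 2)
    have hD : Tendsto D (𝓝[>] 0) (𝓝 0) := hinit (2 * R ^ 2)
    have hlim : Tendsto (fun τ => ENNReal.ofReal (1 + θ) * kineticEnergySq m u₀ +
        ENNReal.ofReal ((1 + θ⁻¹) * |B|) * D τ + ENNReal.ofReal (err R)) (𝓝[>] 0)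
        (𝓝 (ENNReal.ofReal (1 + θ) * kineticEnergySq m u₀ + ENNReal.ofReal (err R))) := by
      have h1 := ENNReal.Tendsto.const_mul (a := ENNReal.ofReal ((1 + θ⁻¹) * |B|)) hD
        (Or.inr ENNReal.ofReal_ne_top)
      have h2 := (h1.const_add (ENNReal.ofReal (1 + θ) * kineticEnergySq m u₀)).add_const
        (ENNReal.ofReal (err R))
      simpa using h2
    refine ge_of_tendsto hlim ?_
    filter_upwards [Ioo_mem_nhdsGT ht] with τ hτ
    refine (h R hR τ t hτ.1 hτ.2 (by linarith)).trans (add_le_add_left ?_ _)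
    have hut : Continuous fun p : ℝ × ℝ => u τ p.1 p.2 :=
      (contDiff_slice hu.contDiffOn hτ.1).continuous
    have hmd : Measurable fun p : ℝ × ℝ => ENNReal.ofReal ((u τ p.1 p.2 - u₀ p.1 p.2) ^ 2) := by
      have := hut.measurable
      fun_prop
    have hDτ : D τ = ∫⁻ p : ℝ × ℝ, (phaseBox R).indicator
        (fun p => ENNReal.ofReal ((u τ p.1 p.2 - u₀ p.1 p.2) ^ 2)) p := by
      rw [lintegral_indicator (isCompact_phaseBox R).isClosed.measurableSet, phaseBox,
        Measure.volume_eq_prod, ← Measure.prod_restrict, lintegral_prod _ hmd.aemeasurable]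
    rw [hDτ, hE₀, ← lintegral_const_mul' _ _ ENNReal.ofReal_ne_top,
      ← lintegral_const_mul' _ _ ENNReal.ofReal_ne_top, ← lintegral_add_left (by fun_prop)]
    refine lintegral_mono fun p => ?_
    by_cases hp : p ∈ phaseBox R
    · rw [indicator_of_mem hp, ← ENNReal.ofReal_mul (by positivity),
        ← ENNReal.ofReal_mul (by positivity), ← ENNReal.ofReal_add
          (mul_nonneg (by positivity) (div_nonneg (sq_nonneg _) (hm _).le)) (by positivity)]
      refine ENNReal.ofReal_le_ofReal ?_
      refine (mul_le_of_le_one_left (div_nonneg (sq_nonneg _) (hm _).le)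
        (phaseCutoff_le_one R p)).trans ?_
      set y := u τ p.1 p.2
      set z := u₀ p.1 p.2
      have hmp := hm p.2
      have h1 : y ^ 2 ≤ (1 + θ) * z ^ 2 + (1 + θ⁻¹) * (y - z) ^ 2 := by
        have h2 : (1 + θ) * z ^ 2 + (1 + θ⁻¹) * (y - z) ^ 2 - y ^ 2 =
            θ⁻¹ * (θ * z - (y - z)) ^ 2 := by
          field_simp
          ring
        have h3 : 0 ≤ θ⁻¹ * (θ * z - (y - z)) ^ 2 := by positivity
        linarith
      have h2 : (m p.2)⁻¹ ≤ |B| := (le_abs_self _).trans ((hB p.2 hp.2).trans (le_abs_self B))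
      calc y ^ 2 / m p.2 ≤ ((1 + θ) * z ^ 2 + (1 + θ⁻¹) * (y - z) ^ 2) / m p.2 := by gcongr
        _ = (1 + θ) * (z ^ 2 / m p.2) + (1 + θ⁻¹) * (y - z) ^ 2 * (m p.2)⁻¹ := by
          rw [add_div, mul_div_assoc, div_eq_mul_inv ((1 + θ⁻¹) * (y - z) ^ 2)]
        _ ≤ (1 + θ) * (z ^ 2 / m p.2) + (1 + θ⁻¹) * (y - z) ^ 2 * |B| := by gcongr
        _ = _ := by ring
    · rw [phaseCutoff_eq_zero hR hp, zero_mul, ENNReal.ofReal_zero]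
      exact zero_le
  have hlim : Tendsto (fun θ : ℝ => ENNReal.ofReal (1 + θ) * kineticEnergySq m u₀) (𝓝[>] 0)
      (𝓝 (kineticEnergySq m u₀)) := by
    have h1 : Tendsto (fun θ : ℝ => ENNReal.ofReal (1 + θ)) (𝓝[>] 0) (𝓝 1) := by
      have h2 : Tendsto (fun θ : ℝ => 1 + θ) (𝓝[>] 0) (𝓝 1) := by
        have : Tendsto (fun θ : ℝ => 1 + θ) (𝓝 0) (𝓝 (1 + 0)) := tendsto_id.const_add 1
        rw [add_zero] at this
        exact this.mono_left nhdsWithin_le_nhds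
      simpa using ENNReal.tendsto_ofReal h2
    simpa using ENNReal.Tendsto.mul_const h1 (Or.inl one_ne_zero)
  refine ge_of_tendsto hlim ?_
  filter_upwards [self_mem_nhdsWithin] with θ hθ
  exact key θ hθ

end IsKineticSolution

/-! ### Operations on initial data -/

theorem measurable_initialDensity {fin : ℝ → ℝ → ℝ} (hfin : Measurable (Function.uncurry fin)) :
    Measurable (initialDensity fin) :=
  hfin.stronglyMeasurable.integral_prod_right.measurable

theorem measurable_etaIn {ε : ℝ} {fin : ℝ → ℝ → ℝ} (hfin : Measurable (Function.uncurry fin)) :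
    Measurable (Function.uncurry (etaIn ε fin)) := by
  have := measurable_initialDensity hfin
  unfold etaIn Function.uncurry
  fun_prop

theorem AttainsInitialData.of_sq_le {u w z : ℝ → ℝ → ℝ → ℝ} {u₀ w₀ z₀ : ℝ → ℝ → ℝ}
    (hu : AttainsInitialData u u₀) (hw : AttainsInitialData w w₀)
    (hum : ∀ t > 0, Measurable fun p : ℝ × ℝ => u t p.1 p.2)
    (hu₀ : Measurable fun p : ℝ × ℝ => u₀ p.1 p.2)
    (h : ∀ R : ℝ, ∃ C : ℝ, 0 ≤ C ∧ ∀ t > 0, ∀ x ∈ Icc (-R) R, ∀ v ∈ Icc (-R) R,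
      (z t x v - z₀ x v) ^ 2 ≤ C * ((u t x v - u₀ x v) ^ 2 + (w t x v - w₀ x v) ^ 2)) :
    AttainsInitialData z z₀ := by
  intro R
  obtain ⟨C, hC, hle⟩ := h R
  have hlim := ENNReal.Tendsto.const_mul (a := ENNReal.ofReal C) ((hu R).add (hw R))
    (Or.inr ENNReal.ofReal_ne_top)
  rw [add_zero, mul_zero] at hlim
  refine tendsto_of_tendsto_of_tendsto_of_le_of_le' tendsto_const_nhds hlim
    (Eventually.of_forall fun _ => zero_le) ?_
  filter_upwards [self_mem_nhdsWithin] with t ht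
  have hm : Measurable fun p : ℝ × ℝ => ENNReal.ofReal ((u t p.1 p.2 - u₀ p.1 p.2) ^ 2) := by
    have := hum t ht
    fun_prop
  have hm1 : Measurable fun x => ∫⁻ v in Icc (-R) R, ENNReal.ofReal ((u t x v - u₀ x v) ^ 2) :=
    hm.lintegral_prod_right'
  rw [← lintegral_add_left hm1, ← lintegral_const_mul' _ _ ENNReal.ofReal_ne_top]
  refine setLIntegral_mono' measurableSet_Icc fun x hx => ?_
  have hm2 : Measurable fun v => ENNReal.ofReal ((u t x v - u₀ x v) ^ 2) :=
    hm.comp (measurable_const.prodMk measurable_id)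
  rw [← lintegral_add_left hm2, ← lintegral_const_mul' _ _ ENNReal.ofReal_ne_top]
  refine setLIntegral_mono' measurableSet_Icc fun v hv => ?_
  rw [← ENNReal.ofReal_add (sq_nonneg _) (sq_nonneg _), ← ENNReal.ofReal_mul hC]
  exact ENNReal.ofReal_le_ofReal (hle t ht x hx v hv)

theorem AttainsInitialData.swap {u : ℝ → ℝ → ℝ → ℝ} {u₀ : ℝ → ℝ → ℝ}
    (hu : AttainsInitialData u u₀) (hum : ∀ t > 0, Measurable fun p : ℝ × ℝ => u t p.1 p.2)
    (hu₀ : Measurable fun p : ℝ × ℝ => u₀ p.1 p.2) :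
    AttainsInitialData (fun t x v => u t v x) (fun x v => u₀ v x) := by
  intro R
  refine (hu R).congr' ?_
  filter_upwards [self_mem_nhdsWithin] with t ht
  have := hum t ht
  have hm : Measurable fun p : ℝ × ℝ => ENNReal.ofReal ((u t p.1 p.2 - u₀ p.1 p.2) ^ 2) := by
    fun_prop
  exact lintegral_lintegral_swap hm.aemeasurable

theorem setLIntegral_Icc_comp_add_le (F : ℝ → ℝ≥0∞) {R S c : ℝ} (h : R + |c| ≤ S) :
    ∫⁻ v in Icc (-R) R, F (v + c) ≤ ∫⁻ v in Icc (-S) S, F v := by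
  rw [← lintegral_indicator measurableSet_Icc, ← lintegral_indicator measurableSet_Icc,
    ← lintegral_add_right_eq_self ((Icc (-S) S).indicator F) c]
  refine lintegral_mono fun v => ?_
  refine indicator_apply_le' (fun hv => ?_) (fun _ => zero_le)
  have := neg_abs_le c
  have := le_abs_self c
  rw [indicator_of_mem]
  exact ⟨by linarith [hv.1], by linarith [hv.2]⟩

theorem AttainsInitialData.translate {u : ℝ → ℝ → ℝ → ℝ} {u₀ : ℝ → ℝ → ℝ}
    (hu : AttainsInitialData u u₀) (c d : ℝ) :
    AttainsInitialData (fun t x v => u t (x + c) (v + d)) (fun x v => u₀ (x + c) (v + d)) := by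
  intro R
  refine tendsto_of_tendsto_of_tendsto_of_le_of_le tendsto_const_nhds (hu (R + |c| + |d|))
    (fun _ => zero_le) fun t => ?_
  refine le_trans ?_ (setLIntegral_Icc_comp_add_le _ (c := c) (R := R)
    (le_add_of_nonneg_right (abs_nonneg d)))
  refine lintegral_mono fun x => ?_
  exact setLIntegral_Icc_comp_add_le
    (fun v => ENNReal.ofReal ((u t (x + c) v - u₀ (x + c) v) ^ 2))
    (by linarith [abs_nonneg c])

/-! ### The fractional heat equation -/

/-- A finite-energy classical solution of `∂_t η = -(-Δ_x)^s η`, with `v` as a parameter and energy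
measured against the weight `w(v)`. -/
structure IsHeatSolution (s : ℝ) (w : ℝ → ℝ) (η : ℝ → ℝ → ℝ → ℝ) : Prop where
  contDiffOn :
    ContDiffOn ℝ 2 (fun p : ℝ × ℝ × ℝ => η p.1 p.2.1 p.2.2) (Ioi (0 : ℝ) ×ˢ univ)
  equation : ∀ t : ℝ, 0 < t → ∀ x v : ℝ, ∃ l : ℝ,
    HasFracLaplacian s (fun y => η t y v) x l ∧ deriv (fun τ => η τ x v) t = -l
  energy : ∀ T : ℝ, ∫⁻ t in Ioo 0 T, macroEnergySq w (η t) < ∞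

theorem hasFracLaplacian_one (s v : ℝ) :
    HasFracLaplacian s (fun _ : ℝ => (1 : ℝ)) v (0 * deriv (fun w : ℝ => w * 1) v) := by
  rw [zero_mul]
  exact hasFracLaplacian_const s 1 v

theorem kineticEnergySq_one_swap {w : ℝ → ℝ} (hw : Measurable w) (hw0 : ∀ v, 0 < w v)
    {z : ℝ → ℝ → ℝ} (hz : Measurable fun p : ℝ × ℝ => z p.1 p.2) :
    kineticEnergySq (fun _ => 1) (fun x v => √(w x) * z v x) = macroEnergySq w z := by
  have hm : AEMeasurable (Function.uncurry fun x v => ENNReal.ofReal (z x v ^ 2 * w v))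
      (volume.prod volume) := by
    unfold Function.uncurry
    exact Measurable.aemeasurable (by fun_prop)
  unfold kineticEnergySq macroEnergySq
  rw [lintegral_lintegral_swap hm]
  refine lintegral_congr fun x => lintegral_congr fun v => ?_
  rw [div_one, mul_pow, Real.sq_sqrt (hw0 x).le, mul_comm]

namespace IsHeatSolution

variable {s : ℝ} {w : ℝ → ℝ} {η : ℝ → ℝ → ℝ → ℝ}

theorem measurable_slice (hη : IsHeatSolution s w η) :
    ∀ t > 0, Measurable fun p : ℝ × ℝ => η t p.1 p.2 :=
  fun _ ht => (contDiff_slice hη.contDiffOn ht).continuous.measurable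

/-- With the roles of `x` and `v` exchanged, and the weight absorbed into the solution, the heat
equation is the case without transport and drift, for which constants are stationary. -/
theorem isKineticSolution (hη : IsHeatSolution s w η) (hw2 : ContDiff ℝ 2 w)
    (hw : ∀ v, 0 < w v) :
    IsKineticSolution s 1 0 0 (fun _ => 1) (fun t x v => √(w x) * η t v x) where
  contDiffOn := by
    have h1 : ContDiff ℝ 2 fun x => √(w x) := hw2.sqrt fun x => (hw x).ne'
    have h2 : ContDiff ℝ 2 fun p : ℝ × ℝ × ℝ => √(w p.2.1) := h1.comp (by fun_prop)
    refine h2.contDiffOn.mul (hη.contDiffOn.comp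
      (f := fun p : ℝ × ℝ × ℝ => (p.1, p.2.2, p.2.1)) (by fun_prop) fun p hp => ?_)
    exact mk_mem_prod hp.1 (mem_univ _)
  equation t ht x v := by
    obtain ⟨l, hl, heq⟩ := hη.equation t ht v x
    refine ⟨√(w x) * l, hl.const_mul _, ?_⟩
    have : deriv (fun τ => √(w x) * η τ v x) t = √(w x) * deriv (fun τ => η τ v x) t :=
      deriv_const_mul_field _
    rw [this, heq]
    ring
  energy T := by
    refine lt_of_eq_of_lt (setLIntegral_congr_fun measurableSet_Ioo fun t ht => ?_) (hη.energy T)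
    exact kineticEnergySq_one_swap hw2.continuous.measurable hw (hη.measurable_slice t ht.1)

theorem kineticEnergySq_eq_macroEnergySq (hη : IsHeatSolution s w η) (hw2 : ContDiff ℝ 2 w)
    (hw : ∀ v, 0 < w v) {t : ℝ} (ht : 0 < t) :
    kineticEnergySq (fun _ => 1) (fun x v => √(w x) * η t v x) = macroEnergySq w (η t) :=
  kineticEnergySq_one_swap hw2.continuous.measurable hw (hη.measurable_slice t ht)

theorem macroEnergySq_antitone (hη : IsHeatSolution s w η) (hs : s ∈ Ioo (0 : ℝ) 1)
    (hw2 : ContDiff ℝ 2 w) (hw : ∀ v, 0 < w v) :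
    AntitoneOn (fun t => macroEnergySq w (η t)) (Ioi 0) := by
  have h := (hη.isKineticSolution hw2 hw).kineticEnergySq_antitone hs one_pos le_rfl
    contDiff_const (fun _ => one_pos) (hasFracLaplacian_one s)
  exact h.congr fun t ht => hη.kineticEnergySq_eq_macroEnergySq hw2 hw ht

theorem aemeasurable_macroEnergySq (hη : IsHeatSolution s w η) (hw2 : ContDiff ℝ 2 w)
    (hw : ∀ v, 0 < w v) (T : ℝ) :
    AEMeasurable (fun t => macroEnergySq w (η t)) (volume.restrict (Ioo 0 T)) := by
  refine ((hη.isKineticSolution hw2 hw).aemeasurable_kineticEnergySq contDiff_const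
    (fun _ => one_pos) T).congr ?_
  filter_upwards [ae_restrict_mem measurableSet_Ioo] with t ht
  exact hη.kineticEnergySq_eq_macroEnergySq hw2 hw ht.1

theorem macroEnergySq_le_initial (hη : IsHeatSolution s w η) (hs : s ∈ Ioo (0 : ℝ) 1)
    (hw2 : ContDiff ℝ 2 w) (hw : ∀ v, 0 < w v) {η₀ : ℝ → ℝ → ℝ}
    (hη₀ : Measurable (Function.uncurry η₀)) (hinit : AttainsInitialData η η₀) {t : ℝ}
    (ht : 0 < t) : macroEnergySq w (η t) ≤ macroEnergySq w η₀ := by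
  have hη₀' : Measurable fun p : ℝ × ℝ => η₀ p.1 p.2 := hη₀
  have hwm := hw2.continuous.measurable
  have hsw := hinit.swap hη.measurable_slice hη₀'
  have hinit' : AttainsInitialData (fun t x v => √(w x) * η t v x)
      (fun x v => √(w x) * η₀ v x) := by
    refine AttainsInitialData.of_sq_le hsw hsw
      (fun t ht => (hη.measurable_slice t ht).comp measurable_swap)
      (hη₀'.comp measurable_swap) fun R => ?_
    obtain ⟨C, hC⟩ := (isCompact_Icc (a := -R) (b := R)).exists_bound_of_continuousOn
      hw2.continuous.continuousOn
    refine ⟨|C|, abs_nonneg C, fun t ht x hx v hv => ?_⟩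
    rw [← mul_sub, mul_pow, Real.sq_sqrt (hw x).le]
    have h1 : w x ≤ |C| := (le_abs_self _).trans ((hC x hx).trans (le_abs_self C))
    have h2 := sq_nonneg (η t v x - η₀ v x)
    nlinarith [abs_nonneg C]
  have h := (hη.isKineticSolution hw2 hw).kineticEnergySq_le_initial hs one_pos le_rfl
    contDiff_const (fun _ => one_pos) (hasFracLaplacian_one s)
    (u₀ := fun x v => √(w x) * η₀ v x) (by unfold Function.uncurry; fun_prop) hinit' ht
  rwa [hη.kineticEnergySq_eq_macroEnergySq hw2 hw ht, kineticEnergySq_one_swap hwm hw hη₀'] at h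

/-- Uniqueness for the fractional heat equation in the finite-energy class. -/
theorem eq_zero_of_initial (hη : IsHeatSolution s w η) (hs : s ∈ Ioo (0 : ℝ) 1)
    (hw2 : ContDiff ℝ 2 w) (hw : ∀ v, 0 < w v)
    (hinit : AttainsInitialData η fun _ _ => 0) {t : ℝ} (ht : 0 < t) (x v : ℝ) : η t x v = 0 := by
  have h := hη.macroEnergySq_le_initial hs hw2 hw measurable_const hinit ht
  have hc : Continuous fun p : ℝ × ℝ => η t p.1 p.2 ^ 2 * w p.2 :=
    ((contDiff_slice hη.contDiffOn ht).continuous.pow 2).mul (hw2.continuous.comp continuous_snd)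
  have h0 : macroEnergySq w (η t) = 0 := by
    simpa [macroEnergySq] using h
  have h1 : ∫⁻ p : ℝ × ℝ, ENNReal.ofReal (η t p.1 p.2 ^ 2 * w p.2) = 0 :=
    (lintegral_prod (fun p : ℝ × ℝ => ENNReal.ofReal (η t p.1 p.2 ^ 2 * w p.2))
      hc.measurable.ennreal_ofReal.aemeasurable).trans h0
  rw [lintegral_eq_zero_iff hc.measurable.ennreal_ofReal] at h1
  have h2 := congrFun ((Continuous.ae_eq_iff_eq volume (ENNReal.continuous_ofReal.comp hc)
    continuous_const).1 h1) (x, v)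
  have h3 : η t x v ^ 2 * w v ≤ 0 := ENNReal.ofReal_eq_zero.1 h2
  have h4 : η t x v ^ 2 ≤ 0 := by
    by_contra hcon
    exact absurd h3 (not_le.2 (mul_pos (not_le.1 hcon) (hw v)))
  exact pow_eq_zero_iff two_ne_zero |>.1 (le_antisymm h4 (sq_nonneg _))

end IsHeatSolution

theorem IsSolution.isHeatSolution {s ε : ℝ} {M : ℝ → ℝ} {fin : ℝ → ℝ → ℝ}
    {η g : ℝ → ℝ → ℝ → ℝ} (hsol : IsSolution s ε M fin η g) : IsHeatSolution s M η :=
  ⟨hsol.contDiffOn_eta, hsol.macro_equation, hsol.energy_eta⟩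

/-- The macroscopic density depends on `(x, v)` through `x + ε v` only. Both sides solve the
fractional heat equation with the same datum. The weight, half the harmonic mean of the two
weights, makes the energy of their difference finite. -/
theorem IsSolution.eta_eq_translate {s ε : ℝ} (hs : s ∈ Ioo (0 : ℝ) 1) {M : ℝ → ℝ}
    (hM2 : ContDiff ℝ 2 M) (hM : ∀ v, 0 < M v) {fin : ℝ → ℝ → ℝ}
    (hfin : Measurable (Function.uncurry fin)) {η g : ℝ → ℝ → ℝ → ℝ}
    (hsol : IsSolution s ε M fin η g) {t : ℝ} (ht : 0 < t) (x v c : ℝ) :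
    η t x v = η t (x + ε * c) (v + -c) := by
  have hη := hsol.isHeatSolution
  let w : ℝ → ℝ := fun v => M v * M (v + -c) / (M v + M (v + -c))
  have hMc : ContDiff ℝ 2 fun v => M (v + -c) := hM2.comp (by fun_prop)
  have hw2 : ContDiff ℝ 2 w :=
    (hM2.mul hMc).div (hM2.add hMc) fun v => (add_pos (hM _) (hM _)).ne'
  have hw : ∀ v, 0 < w v := fun v =>
    div_pos (mul_pos (hM _) (hM _)) (add_pos (hM _) (hM _))
  have hw1 : ∀ v, w v ≤ M v := by
    intro v
    have h1 := hM v
    have h2 := hM (v + -c)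
    rw [div_le_iff₀ (by positivity)]
    nlinarith
  have hw3 : ∀ v, w v ≤ M (v + -c) := by
    intro v
    have h1 := hM v
    have h2 := hM (v + -c)
    rw [div_le_iff₀ (by positivity)]
    nlinarith
  let d : ℝ → ℝ → ℝ → ℝ := fun t x v => η t x v - η t (x + ε * c) (v + -c)
  have hmeas := hη.measurable_slice
  have hMm := hM2.continuous.measurable
  have hden : ∀ t > 0, macroEnergySq w (d t) ≤ 4 * macroEnergySq M (η t) := by
    intro t ht
    have hm : Measurable fun p : ℝ × ℝ => ENNReal.ofReal (η t p.1 p.2 ^ 2 * M p.2) := by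
      have := hmeas t ht
      fun_prop
    have hm1 : Measurable fun x => ∫⁻ v, ENNReal.ofReal (η t x v ^ 2 * M v) :=
      hm.lintegral_prod_right'
    have e1 : macroEnergySq M (η t) = ∫⁻ x, ∫⁻ v, ENNReal.ofReal
        (η t (x + ε * c) (v + -c) ^ 2 * M (v + -c)) := by
      unfold macroEnergySq
      rw [← lintegral_add_right_eq_self _ (ε * c)]
      refine lintegral_congr fun x => ?_
      exact (lintegral_add_right_eq_self
        (fun v => ENNReal.ofReal (η t (x + ε * c) v ^ 2 * M v)) (-c)).symm
    have e2 : 4 * macroEnergySq M (η t) = 2 * (macroEnergySq M (η t) + ∫⁻ x, ∫⁻ v, ENNReal.ofReal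
        (η t (x + ε * c) (v + -c) ^ 2 * M (v + -c))) := by
      rw [← e1, ← two_mul, ← mul_assoc]
      norm_num
    rw [e2]
    unfold macroEnergySq
    rw [← lintegral_add_left hm1, ← lintegral_const_mul' _ _ ENNReal.ofNat_ne_top]
    refine lintegral_mono fun x => ?_
    have hm2 : Measurable fun v => ENNReal.ofReal (η t x v ^ 2 * M v) :=
      hm.comp (measurable_const.prodMk measurable_id)
    rw [← lintegral_add_left hm2, ← lintegral_const_mul' _ _ ENNReal.ofNat_ne_top]
    refine lintegral_mono fun v => ?_
    have h1 := hM v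
    have h2 := hM (v + -c)
    rw [← ENNReal.ofReal_add (by positivity) (by positivity), ← ENNReal.ofReal_ofNat 2,
      ← ENNReal.ofReal_mul zero_le_two]
    refine ENNReal.ofReal_le_ofReal ?_
    simp only [d]
    set y := η t x v
    set z := η t (x + ε * c) (v + -c)
    have k1 := mul_le_mul_of_nonneg_left (hw1 v) (sq_nonneg y)
    have k2 := mul_le_mul_of_nonneg_left (hw3 v) (sq_nonneg z)
    have k3 := mul_nonneg (hw v).le (sq_nonneg (y + z))
    linarith
  have hd : IsHeatSolution s w d := by
    refine ⟨hη.contDiffOn.sub (hη.contDiffOn.comp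
      (f := fun p : ℝ × ℝ × ℝ => (p.1, p.2.1 + ε * c, p.2.2 + -c)) (by fun_prop) fun p hp =>
      mk_mem_prod hp.1 (mem_univ _)), fun t ht x v => ?_, fun T => ?_⟩
    · obtain ⟨l₁, h1, e1⟩ := hη.equation t ht x v
      obtain ⟨l₂, h2, e2⟩ := hη.equation t ht (x + ε * c) (v + -c)
      have h3 := (h2.comp_affine one_pos x).const_mul (-1)
      simp only [Real.one_rpow, one_mul] at h3
      refine ⟨l₁ + -1 * l₂, ?_, ?_⟩
      · convert h1.add h3 using 2 with y
        simp only [d]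
        rw [show x + ε * c + (y - x) = y + ε * c by ring]
        ring
      · obtain ⟨ηt, _, _, _, hE⟩ := exists_partial_derivs hη.contDiffOn
        have k1 := (hE t ht x v).1
        have k2 := (hE t ht (x + ε * c) (v + -c)).1
        rw [k1.deriv] at e1
        rw [k2.deriv] at e2
        have k3 : HasDerivAt (fun τ => d τ x v) _ t := k1.sub k2
        rw [k3.deriv, e1, e2]
        ring
    · refine lt_of_le_of_lt (setLIntegral_mono' measurableSet_Ioo fun t ht => hden t ht.1) ?_
      rw [lintegral_const_mul' _ _ ENNReal.ofNat_ne_top]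
      exact ENNReal.mul_lt_top ENNReal.ofNat_lt_top (hη.energy T)
  have hinit : AttainsInitialData d fun _ _ => 0 := by
    refine AttainsInitialData.of_sq_le hsol.initial_eta
      (hsol.initial_eta.translate (ε * c) (-c)) hmeas (measurable_etaIn hfin) fun R =>
      ⟨2, zero_le_two, fun t ht x _ v _ => ?_⟩
    have e1 : etaIn ε fin (x + ε * c) (v + -c) = etaIn ε fin x v := by
      simp only [etaIn]
      congr 1
      ring
    rw [e1]
    simp only [d]
    nlinarith [sq_nonneg (η t x v - etaIn ε fin x v +
      (η t (x + ε * c) (v + -c) - etaIn ε fin x v))]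
  exact sub_eq_zero.1 (hd.eq_zero_of_initial hs hw2 hw hinit ht x v)

/-! ### The total density and the energy bounds -/

theorem kineticEnergySq_add_le {M : ℝ → ℝ} (hMm : Measurable M) (hM : ∀ v, 0 < M v)
    {p q : ℝ → ℝ → ℝ} (hp : Measurable fun y : ℝ × ℝ => p y.1 y.2) :
    kineticEnergySq M (fun x v => p x v * M v + q x v) ≤
      2 * kineticEnergySq M q + 2 * macroEnergySq M p := by
  have hm : Measurable fun y : ℝ × ℝ => ENNReal.ofReal (p y.1 y.2 ^ 2 * M y.2) := by fun_prop
  have hm1 : Measurable fun x => ∫⁻ v, ENNReal.ofReal (p x v ^ 2 * M v) :=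
    hm.lintegral_prod_right'
  rw [← mul_add]
  unfold kineticEnergySq macroEnergySq
  rw [← lintegral_add_right _ hm1, ← lintegral_const_mul' _ _ ENNReal.ofNat_ne_top]
  refine lintegral_mono fun x => ?_
  have hm2 : Measurable fun v => ENNReal.ofReal (p x v ^ 2 * M v) :=
    hm.comp (measurable_const.prodMk measurable_id)
  rw [← lintegral_add_right _ hm2, ← lintegral_const_mul' _ _ ENNReal.ofNat_ne_top]
  refine lintegral_mono fun v => ?_
  have h1 := hM v
  rw [← ENNReal.ofReal_add (by positivity) (by positivity), ← ENNReal.ofReal_ofNat 2,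
    ← ENNReal.ofReal_mul zero_le_two]
  refine ENNReal.ofReal_le_ofReal ?_
  have e : 2 * (q x v ^ 2 / M v + p x v ^ 2 * M v) - (p x v * M v + q x v) ^ 2 / M v =
      (p x v * M v - q x v) ^ 2 / M v := by
    field_simp
    ring
  have : 0 ≤ (p x v * M v - q x v) ^ 2 / M v := by positivity
  linarith

/-- By the Cauchy-Schwarz inequality, the initial macroscopic energy is at most the initial total
energy. -/
theorem macroEnergySq_etaIn_le {M : ℝ → ℝ} (hMm : Measurable M) (hM : ∀ v, 0 < M v)
    (hM1 : ∫ v, M v = 1) (ε : ℝ) {fin : ℝ → ℝ → ℝ} (hfin : Measurable (Function.uncurry fin)) :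
    macroEnergySq M (etaIn ε fin) ≤ kineticEnergySq M fin := by
  have hMi : Integrable M := by
    by_contra hcon
    rw [integral_undef hcon] at hM1
    exact zero_ne_one hM1
  have hMl : ∫⁻ v, ENNReal.ofReal (M v) = 1 := by
    rw [← ofReal_integral_eq_lintegral_ofReal hMi (ae_of_all _ fun v => (hM v).le), hM1,
      ENNReal.ofReal_one]
  have hρ : ∀ x, ENNReal.ofReal (initialDensity fin x ^ 2) ≤
      ∫⁻ v, ENNReal.ofReal (fin x v ^ 2 / M v) := by
    intro x
    have hfx : Measurable (fin x) := hfin.comp (measurable_const.prodMk measurable_id)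
    have h1 : ‖initialDensity fin x‖ₑ ≤ ∫⁻ v, ‖fin x v‖ₑ := enorm_integral_le_lintegral_enorm _
    have h2 := ENNReal.lintegral_mul_le_Lp_mul_Lq volume Real.HolderConjugate.two_two
      (f := fun v => ENNReal.ofReal (|fin x v| / √(M v))) (g := fun v => ENNReal.ofReal √(M v))
      (by fun_prop) (by fun_prop)
    have e1 : ∀ v, ((fun v => ENNReal.ofReal (|fin x v| / √(M v))) *
        fun v => ENNReal.ofReal √(M v)) v = ‖fin x v‖ₑ := by
      intro v
      have := Real.sqrt_pos.2 (hM v)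
      rw [Pi.mul_apply, ← ENNReal.ofReal_mul (by positivity), div_mul_cancel₀ _ this.ne',
        ← Real.norm_eq_abs, ofReal_norm]
    have e2 : ∀ v, ENNReal.ofReal (|fin x v| / √(M v)) ^ (2 : ℝ) =
        ENNReal.ofReal (fin x v ^ 2 / M v) := by
      intro v
      rw [ENNReal.rpow_two, ← ENNReal.ofReal_pow (by positivity), div_pow, sq_abs,
        Real.sq_sqrt (hM v).le]
    have e3 : ∀ v, ENNReal.ofReal √(M v) ^ (2 : ℝ) = ENNReal.ofReal (M v) := by
      intro v
      rw [ENNReal.rpow_two, ← ENNReal.ofReal_pow (by positivity), Real.sq_sqrt (hM v).le]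
    simp only [e1, e2, e3, hMl, ENNReal.one_rpow, mul_one] at h2
    calc ENNReal.ofReal (initialDensity fin x ^ 2) = ‖initialDensity fin x‖ₑ ^ 2 := by
          rw [← ofReal_norm, ← ENNReal.ofReal_pow (norm_nonneg _), Real.norm_eq_abs, sq_abs]
      _ ≤ ((∫⁻ v, ENNReal.ofReal (fin x v ^ 2 / M v)) ^ (1 / (2 : ℝ))) ^ 2 := by
          gcongr
          exact h1.trans h2
      _ = ∫⁻ v, ENNReal.ofReal (fin x v ^ 2 / M v) := by
          rw [← ENNReal.rpow_two, ← ENNReal.rpow_mul]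
          norm_num
  have hρm := measurable_initialDensity hfin
  have hm : AEMeasurable (Function.uncurry fun x v =>
      ENNReal.ofReal (etaIn ε fin x v ^ 2 * M v)) (volume.prod volume) := by
    unfold Function.uncurry etaIn
    exact Measurable.aemeasurable (by fun_prop)
  unfold macroEnergySq
  rw [lintegral_lintegral_swap hm]
  have hinner : ∀ v, ∫⁻ x, ENNReal.ofReal (etaIn ε fin x v ^ 2 * M v) =
      ENNReal.ofReal (M v) * ∫⁻ x, ENNReal.ofReal (initialDensity fin x ^ 2) := by
    intro v
    rw [← lintegral_add_right_eq_self (fun x => ENNReal.ofReal (initialDensity fin x ^ 2)) (ε * v),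
      ← lintegral_const_mul' _ _ ENNReal.ofReal_ne_top]
    refine lintegral_congr fun x => ?_
    rw [← ENNReal.ofReal_mul (hM v).le, mul_comm, etaIn]
  simp only [hinner]
  rw [lintegral_mul_const _ hMm.ennreal_ofReal, hMl, one_mul]
  exact lintegral_mono hρ

theorem IsEquilibrium.hasFracLaplacian {s : ℝ} {M : ℝ → ℝ} (hM : IsEquilibrium s M) (v : ℝ) :
    HasFracLaplacian s M v (1 * deriv (fun w => w * M w) v) := by
  obtain ⟨-, a, ha, h0⟩ := hM.equation v
  rwa [one_mul, sub_eq_zero.1 h0.symm]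

/-- The total density `f = η M + g` solves the kinetic Lévy-Fokker-Planck equation: since `η`
depends on `x + ε v` only, the terms produced by `η M` cancel, and the commutator is the defect in
the Leibniz rule for `(-Δ_v)^s (η M)`. -/
theorem IsSolution.isKineticSolution {s ε : ℝ} (hs : s ∈ Ioo (0 : ℝ) 1) (hε : 0 < ε) {M : ℝ → ℝ}
    (hM : IsEquilibrium s M) {fin : ℝ → ℝ → ℝ} (hfin : Measurable (Function.uncurry fin))
    {η g : ℝ → ℝ → ℝ → ℝ} (hsol : IsSolution s ε M fin η g) :
    IsKineticSolution s (ε ^ (2 * s)) ε 1 M (fun t x v => η t x v * M v + g t x v) where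
  contDiffOn := by
    have h1 : ContDiff ℝ 2 fun p : ℝ × ℝ × ℝ => M p.2.2 := hM.contDiff.comp (by fun_prop)
    exact (hsol.contDiffOn_eta.mul h1.contDiffOn).add hsol.contDiffOn_g
  equation t ht x v := by
    obtain ⟨l, ⟨-, ag, hag, hl⟩, hmicro⟩ := hsol.micro_equation t ht x v
    obtain ⟨lη, hlη, hheat⟩ := hsol.macro_equation t ht x v
    have htrans : ∀ w, η t x w = η t (x + ε * (w - v)) v := by
      intro w
      rw [hsol.eta_eq_translate hs hM.contDiff hM.pos hfin ht x w (w - v)]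
      congr 1
      ring
    have hηv : HasFracLaplacian s (η t x) v (ε ^ (2 * s) * lη) := by
      rw [show η t x = fun w => η t (x + ε * (w - v)) v from funext htrans]
      exact hlη.comp_affine hε v
    have hprod := hηv.mul (hM.hasFracLaplacian v) (hsol.comm_integrable t ht x v)
    refine ⟨_, hprod.add hag, ?_⟩
    obtain ⟨ηt, ηx, _, _, hη'⟩ := exists_partial_derivs hsol.contDiffOn_eta
    obtain ⟨gt, gx, _, _, hg'⟩ := exists_partial_derivs hsol.contDiffOn_g
    obtain ⟨hηt, hηx⟩ := hη' t ht x v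
    obtain ⟨hgt, hgx⟩ := hg' t ht x v
    have hηv' : HasDerivAt (η t x) (ηx (t, x, v) * ε) v := by
      have h1 : HasDerivAt (fun w => x + ε * (w - v)) ε v := by
        simpa using (((hasDerivAt_id v).sub_const v).const_mul ε).const_add x
      have h2 : HasDerivAt (fun y => η t y v) (ηx (t, x, v)) (x + ε * (v - v)) := by
        simpa using hηx
      rw [show η t x = fun w => η t (x + ε * (w - v)) v from funext htrans]
      exact h2.comp v h1
    have hMd : HasDerivAt M (deriv M v) v :=
      (hM.contDiff.differentiable (by norm_num) v).hasDerivAt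
    have hgv : HasDerivAt (g t x) (deriv (g t x) v) v := by
      have h1 : ContDiff ℝ 2 (g t x) := (contDiff_slice hsol.contDiffOn_g ht).comp
        (f := fun v : ℝ => (x, v)) (by fun_prop)
      exact (h1.differentiable (by norm_num) v).hasDerivAt
    have d1 : HasDerivAt (fun τ => η τ x v * M v + g τ x v) (ηt (t, x, v) * M v + gt (t, x, v)) t :=
      (hηt.mul_const _).add hgt
    have d2 : HasDerivAt (fun y => η t y v * M v + g t y v) (ηx (t, x, v) * M v + gx (t, x, v)) x :=
      (hηx.mul_const _).add hgx
    have d3 : HasDerivAt (fun w => w * (η t x w * M w + g t x w))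
        (1 * (η t x v * M v + g t x v) +
          v * (ηx (t, x, v) * ε * M v + η t x v * deriv M v + deriv (g t x) v)) v :=
      (hasDerivAt_id v).mul ((hηv'.mul hMd).add hgv)
    have d4 : HasDerivAt (fun w => w * M w) (1 * M v + v * deriv M v) v :=
      (hasDerivAt_id v).mul hMd
    have d5 : HasDerivAt (fun w => w * g t x w) (1 * g t x v + v * deriv (g t x) v) v :=
      (hasDerivAt_id v).mul hgv
    rw [hηt.deriv] at hheat
    rw [hgt.deriv, hgx.deriv, hl, d5.deriv] at hmicro
    rw [d1.deriv, d2.deriv, d3.deriv, d4.deriv, hheat]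
    linear_combination hmicro
  energy T := by
    have hη := hsol.isHeatSolution
    refine lt_of_le_of_lt (setLIntegral_mono' measurableSet_Ioo fun t ht =>
      kineticEnergySq_add_le hM.contDiff.continuous.measurable hM.pos
        (hη.measurable_slice t ht.1)) ?_
    rw [lintegral_add_right' _
        ((hη.aemeasurable_macroEnergySq hM.contDiff hM.pos T).const_mul 2),
      lintegral_const_mul' _ _ ENNReal.ofNat_ne_top, lintegral_const_mul' _ _ ENNReal.ofNat_ne_top]
    exact ENNReal.add_lt_top.2 ⟨ENNReal.mul_lt_top ENNReal.ofNat_lt_top (hsol.energy_g T),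
      ENNReal.mul_lt_top ENNReal.ofNat_lt_top (hsol.energy_eta T)⟩

theorem IsSolution.attainsInitialData {s ε : ℝ} {M : ℝ → ℝ} (hM : Continuous M)
    {fin : ℝ → ℝ → ℝ} (hfin : Measurable (Function.uncurry fin)) {η g : ℝ → ℝ → ℝ → ℝ}
    (hsol : IsSolution s ε M fin η g) :
    AttainsInitialData (fun t x v => η t x v * M v + g t x v) fin := by
  refine AttainsInitialData.of_sq_le hsol.initial_eta hsol.initial_g
    hsol.isHeatSolution.measurable_slice (measurable_etaIn hfin) fun R => ?_
  obtain ⟨C, hC⟩ := (isCompact_Icc (a := -R) (b := R)).exists_bound_of_continuousOn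
    hM.continuousOn
  refine ⟨2 * (C ^ 2 + 1), by positivity, fun t ht x _ v hv => ?_⟩
  have h1 : M v ^ 2 ≤ C ^ 2 := sq_le_sq.2 ((hC v hv).trans (le_abs_self C))
  have e : η t x v * M v + g t x v - fin x v =
      (η t x v - etaIn ε fin x v) * M v + (g t x v - gIn ε M fin x v) := by
    simp only [gIn]
    ring
  rw [e]
  set y := η t x v - etaIn ε fin x v
  set z := g t x v - gIn ε M fin x v
  have h2 := mul_le_mul_of_nonneg_left h1 (sq_nonneg y)
  have h3 := mul_nonneg (sq_nonneg C) (sq_nonneg z)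
  nlinarith [sq_nonneg (y * M v - z), sq_nonneg y]

end LevyFokkerPlanck
end

theorem proposition3p3 (s ε : ℝ) (hs : s ∈ Set.Ioo (0 : ℝ) 1) (hε : 0 < ε)
    (M : ℝ → ℝ) (hM : LevyFokkerPlanck.IsEquilibrium s M)
    (fin : ℝ → ℝ → ℝ) (hfin_meas : Measurable (Function.uncurry fin))
    (hfin : LevyFokkerPlanck.kineticEnergySq M fin < ∞)
    (η g : ℝ → ℝ → ℝ → ℝ) (hsol : LevyFokkerPlanck.IsSolution s ε M fin η g) :
    -- `E_η` is non-increasing, and never exceeds its finite initial value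
    AntitoneOn (fun t => LevyFokkerPlanck.macroEnergySq M (η t)) (Set.Ioi 0) ∧
    LevyFokkerPlanck.macroEnergySq M (LevyFokkerPlanck.etaIn ε fin) < ∞ ∧
    (∀ t : ℝ, 0 < t → LevyFokkerPlanck.macroEnergySq M (η t) ≤
      LevyFokkerPlanck.macroEnergySq M (LevyFokkerPlanck.etaIn ε fin)) ∧
    -- `E_g² ≤ 2 E_f² + 2 E_η²` at every time, where `f = η M + g`
    (∀ t : ℝ, 0 < t → LevyFokkerPlanck.kineticEnergySq M (g t) ≤
      2 * LevyFokkerPlanck.kineticEnergySq M (fun x v => η t x v * M v + g t x v) +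
      2 * LevyFokkerPlanck.macroEnergySq M (η t)) ∧
    -- `E_g` is bounded by the initial energies
    (∀ t : ℝ, 0 < t → LevyFokkerPlanck.kineticEnergySq M (g t) ≤
      2 * LevyFokkerPlanck.kineticEnergySq M fin +
      2 * LevyFokkerPlanck.macroEnergySq M (LevyFokkerPlanck.etaIn ε fin)) ∧
    -- both energies are uniformly bounded in time
    (∃ C : ℝ≥0, ∀ t : ℝ, 0 < t → LevyFokkerPlanck.macroEnergySq M (η t) ≤ C ∧
      LevyFokkerPlanck.kineticEnergySq M (g t) ≤ C) := by
  have hM2 := hM.contDiff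
  have hη := hsol.isHeatSolution
  have hηin : LevyFokkerPlanck.macroEnergySq M (LevyFokkerPlanck.etaIn ε fin) < ∞ :=
    (LevyFokkerPlanck.macroEnergySq_etaIn_le hM2.continuous.measurable hM.pos
      hM.integral_eq_one ε hfin_meas).trans_lt hfin
  have hηle : ∀ t : ℝ, 0 < t → LevyFokkerPlanck.macroEnergySq M (η t) ≤
      LevyFokkerPlanck.macroEnergySq M (LevyFokkerPlanck.etaIn ε fin) := fun t ht =>
    hη.macroEnergySq_le_initial hs hM2 hM.pos (LevyFokkerPlanck.measurable_etaIn hfin_meas)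
      hsol.initial_eta ht
  have hsplit : ∀ t : ℝ, 0 < t → LevyFokkerPlanck.kineticEnergySq M (g t) ≤
      2 * LevyFokkerPlanck.kineticEnergySq M (fun x v => η t x v * M v + g t x v) +
      2 * LevyFokkerPlanck.macroEnergySq M (η t) := by
    intro t ht
    have h := LevyFokkerPlanck.kineticEnergySq_add_le hM2.continuous.measurable hM.pos
      (p := fun x v => -η t x v) (q := fun x v => η t x v * M v + g t x v)
      (hη.measurable_slice t ht).neg
    simpa [LevyFokkerPlanck.macroEnergySq] using h
  have hf : ∀ t : ℝ, 0 < t →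
      LevyFokkerPlanck.kineticEnergySq M (fun x v => η t x v * M v + g t x v) ≤
      LevyFokkerPlanck.kineticEnergySq M fin := fun t ht =>
    (hsol.isKineticSolution hs hε hM hfin_meas).kineticEnergySq_le_initial hs
      (Real.rpow_pos_of_pos hε _) zero_le_one hM2 hM.pos hM.hasFracLaplacian hfin_meas
      (hsol.attainsInitialData hM2.continuous hfin_meas) ht
  have hg : ∀ t : ℝ, 0 < t → LevyFokkerPlanck.kineticEnergySq M (g t) ≤
      2 * LevyFokkerPlanck.kineticEnergySq M fin +
      2 * LevyFokkerPlanck.macroEnergySq M (LevyFokkerPlanck.etaIn ε fin) := fun t ht =>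
    (hsplit t ht).trans (add_le_add (mul_le_mul_right (hf t ht) 2) (mul_le_mul_right (hηle t ht) 2))
  refine ⟨hη.macroEnergySq_antitone hs hM2 hM.pos, hηin, hηle, hsplit, hg, ?_⟩
  have hfinite : 2 * LevyFokkerPlanck.kineticEnergySq M fin +
      2 * LevyFokkerPlanck.macroEnergySq M (LevyFokkerPlanck.etaIn ε fin) ≠ ∞ :=
    ENNReal.add_ne_top.2 ⟨ENNReal.mul_ne_top ENNReal.ofNat_ne_top hfin.ne,
      ENNReal.mul_ne_top ENNReal.ofNat_ne_top hηin.ne⟩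
  refine ⟨(2 * LevyFokkerPlanck.kineticEnergySq M fin + 2 *
    LevyFokkerPlanck.macroEnergySq M (LevyFokkerPlanck.etaIn ε fin)).toNNReal, fun t ht => ?_⟩
  rw [ENNReal.coe_toNNReal hfinite]
  exact ⟨(hηle t ht).trans ((le_mul_of_one_le_left' one_le_two).trans le_add_self), hg t ht⟩
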